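/- Let $N\ge 1$, $m_1,\dots,m_N\ge 1$ be integers and $\mathcal D=\{(i,j): 1\le i\le N,\ 1\le j\le m_i\}$. A Lalley–Gatzouras system is a family of maps $S_{ij}(x,y)=(a_{ij}x+c_{ij},\ b_iy+d_i)$, $(i,j)\in\mathcal D$, with all $a_{ij},b_i,c_{ij},d_i\in[0,1]$ and $0<a_{ij}\le b_i<1$ for every $(i,j)\in\mathcal D$, such that $0\le d_1\le\dots\le d_N<1$, $d_{i+1}-d_i\ge b_i$ for $1\le i<N$, $b_N+d_N\le 1$, and, for each $i$, $0\le c_{i1}\le\dots\le c_{im_i}<1$, $c_{i(j+1)}-c_{ij}\ge a_{ij}$ for $1\le j<m_i$, $a_{im_i}+c_{im_i}\le 1$. Let $\Sigma=\mathcal D^{\mathbb N}$ with left shift $\sigma$, let $\Sigma_v=\{1,\dots,N\}^{\mathbb N}$ with left shift $\sigma_v$, and let $\pi:\Sigma\to\Sigma_v$ be the map $((i_n,j_n))_n\mapsto(i_n)_n$. For $\omega\in\Sigma$ let $\Pi(\omega)\in\mathbb R^2$ be the unique point of $\bigcap_{n}S_{\omega_1}\circ\dots\circ S_{\omega_n}([0,1]^2)$.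 For a $\sigma$-invariant Borel probability measure $\mu$ on $\Sigma$ put $\lambda(\mu)=-\int\log a_{\omega_1}\,d\mu(\omega)$ and $\lambda^v(\mu)=-\int\log b_{i_1}\,d\mu(\omega)$, where $\omega_1=(i_1,j_1)$. Let $h(\mu)$ be the Kolmogorov–Sinai entropy of $\mu$ with respect to $\sigma$ and $h^v(\mu)$ that of $\mu\circ\pi^{-1}$ with respect to $\sigma_v$, and set $$D_{LY}(\mu)=\frac{h(\mu)}{\lambda(\mu)}+\Big(\frac1{\lambda^v(\mu)}-\frac1{\lambda(\mu)}\Big)h^v(\mu).$$ Then for every probability vector $\mathbf p=(p_{ij})_{(i,j)\in\mathcal D}$ (zero entries allowed), with $\mu_{\mathbf p}$ the Bernoulli measure on $\Sigma$ with weights $\mathbf p$, the set $$\Lambda(\mathbf p)=\Big\{\Pi(\omega):\ \omega\in\Sigma,\ \lim_{n\to\infty}\tfrac1n\#\{1\le l\le n:\omega_l=(i,j)\}=p_{ij}\text{ for all }(i,j)\in\mathcal D\Big\}$$ has Hausdorff dimension $$\dim\Lambda(\mathbf p)=D_{LY}(\mu_{\mathbf p}).$$ -/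

import Mathlib

open Set Filter Topology MeasureTheory
open scoped ENNReal

namespace LalleyGatzouras

/-! ### Entropy of a measure preserving system -/

section Entropy

variable {X : Type*} [MeasurableSpace X]

/-- Shannon entropy (natural logarithm) of the finite partition of `X` into the fibres of `f`. -/
noncomputable def partitionEntropy {ι : Type*} [Fintype ι] (μ : Measure X) (f : X → ι) : ℝ :=
  ∑ i, Real.negMulLog (μ.real (f ⁻¹' {i}))

/-- The `n`-th itinerary of `x` for the partition into the fibres of `f`. Its fibres form the
join of the preimages of the partition under `T^[0], …, T^[n-1]`. -/
def itinerary {ι : Type*} (T : X → X) (f : X → ι) (n : ℕ) (x : X) : Fin n → ι :=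
  fun l => f (T^[l] x)

/-- Entropy of `T` relative to the partition into the fibres of `f`. For a `T`-invariant
probability measure the sequence converges, so the upper limit is the limit. -/
noncomputable def entropyRel {ι : Type*} [Fintype ι] (μ : Measure X) (T : X → X) (f : X → ι) :
    ℝ≥0∞ :=
  limsup (fun n : ℕ => ENNReal.ofReal (partitionEntropy μ (itinerary T f n) / n)) atTop

/-- Kolmogorov–Sinai entropy: the supremum over all finite measurable partitions. -/
noncomputable def ksEntropy (μ : Measure X) (T : X → X) : ℝ≥0∞ :=
  ⨆ (k : ℕ) (f : X → Fin k) (_ : Measurable f), entropyRel μ T f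

end Entropy

/-- The left shift on one-sided sequences. -/
def shift {A : Type*} (ω : ℕ → A) : ℕ → A := fun n => ω (n + 1)

/-- The digit set `𝒟`: pairs of a row `i` and a position `j` in that row. -/
abbrev Digit {N : ℕ} (m : Fin N → ℕ) : Type := (i : Fin N) × Fin (m i)

/-- The measurable structure on the digit set is the discrete one. -/
instance instDiscreteDigit {N : ℕ} (m : Fin N → ℕ) : DiscreteMeasurableSpace (Digit m) :=
  ⟨fun s => by
    refine MeasurableSpace.measurableSet_iInf.2 fun i => ?_
    exact (MeasurableSet.of_discrete : MeasurableSet (Sigma.mk i ⁻¹' s))⟩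

/-- The Euclidean plane. -/
abbrev Plane : Type := EuclideanSpace ℝ (Fin 2)

/-- The closed unit square. -/
def unitSquare : Set Plane := {x | ∀ k, x k ∈ Icc (0 : ℝ) 1}

/-- A Lalley–Gatzouras system with `N` rows, the `i`-th of which has `m i` digits. -/
structure LGSystem {N : ℕ} (m : Fin N → ℕ) where
  /-- horizontal contraction ratios -/
  a : Digit m → ℝ
  /-- vertical contraction ratios -/
  b : Fin N → ℝ
  /-- horizontal translations -/
  c : Digit m → ℝ
  /-- vertical translations -/
  d : Fin N → ℝ
  b_mem : ∀ i, b i ∈ Icc (0 : ℝ) 1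
  a_pos : ∀ e, 0 < a e
  a_le_b : ∀ e, a e ≤ b e.1
  b_lt_one : ∀ e : Digit m, b e.1 < 1
  d_mem : ∀ i, d i ∈ Ico (0 : ℝ) 1
  d_mono : ∀ i i', i ≤ i' → d i ≤ d i'
  d_gap : ∀ i i' : Fin N, (i' : ℕ) = i + 1 → b i ≤ d i' - d i
  d_last : ∀ i : Fin N, (i : ℕ) + 1 = N → b i + d i ≤ 1
  c_mem : ∀ e, c e ∈ Ico (0 : ℝ) 1
  c_mono : ∀ (i : Fin N) (j j' : Fin (m i)), j ≤ j' → c ⟨i, j⟩ ≤ c ⟨i, j'⟩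
  c_gap : ∀ (i : Fin N) (j j' : Fin (m i)), (j' : ℕ) = j + 1 → a ⟨i, j⟩ ≤ c ⟨i, j'⟩ - c ⟨i, j⟩
  c_last : ∀ (i : Fin N) (j : Fin (m i)), (j : ℕ) + 1 = m i → a ⟨i, j⟩ + c ⟨i, j⟩ ≤ 1

variable {N : ℕ} {m : Fin N → ℕ}

/-- The projection `π` from `𝒟^ℕ` to sequences of rows. -/
def rowProj (ω : ℕ → Digit m) : ℕ → Fin N := fun n => (ω n).1

/-- The measure on `𝒟` that gives mass `p e` to each digit `e`. -/
noncomputable def digitLaw (p : Digit m → ℝ) : Measure (Digit m) :=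
  ∑ e, ENNReal.ofReal (p e) • Measure.dirac e

theorem isProbabilityMeasure_digitLaw (p : stdSimplex ℝ (Digit m)) :
    IsProbabilityMeasure (digitLaw p.1) := by
  constructor
  have h : ∑ e, ENNReal.ofReal (p.1 e) = 1 := by
    rw [← ENNReal.ofReal_sum_of_nonneg fun e _ => p.2.1 e, p.2.2, ENNReal.ofReal_one]
  simpa [digitLaw] using h

/-- The Bernoulli measure on `𝒟^ℕ` with weights `p`: the infinite power of `digitLaw p`. -/
noncomputable def bernoulli (p : stdSimplex ℝ (Digit m)) : Measure (ℕ → Digit m) :=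
  haveI := isProbabilityMeasure_digitLaw p
  Measure.infinitePi fun _ : ℕ => digitLaw p.1

/-- The number of occurrences of the digit `e` among the first `n` terms of `ω`. -/
def digitCount (e : Digit m) (ω : ℕ → Digit m) (n : ℕ) : ℕ :=
  ((Finset.range n).filter fun l => ω l = e).card

/-- The asymptotic frequency of every digit `e` in `ω` exists and equals `p e`. -/
def HasFrequencies (ω : ℕ → Digit m) (p : Digit m → ℝ) : Prop :=
  ∀ e, Tendsto (fun n : ℕ => (digitCount e ω n : ℝ) / n) atTop (𝓝 (p e))

namespace LGSystem

variable (S : LGSystem m)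

/-- The affine contraction attached to the digit `e = (i, j)`. -/
noncomputable def map (e : Digit m) (x : Plane) : Plane :=
  !₂[S.a e * x 0 + S.c e, S.b e.1 * x 1 + S.d e.1]

/-- The composition of the maps attached to the first `n` terms of `ω`, the first term outermost. -/
noncomputable def wordMap (ω : ℕ → Digit m) : ℕ → Plane → Plane
  | 0 => id
  | n + 1 => wordMap ω n ∘ S.map (ω n)

/-- The natural projection `Π` from `𝒟^ℕ` to the plane. The images of the unit square under
`S.wordMap ω n` shrink to the point `S.proj ω`, see `iInter_wordMap_unitSquare`. -/
noncomputable def proj (ω : ℕ → Digit m) : Plane :=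
  limUnder atTop fun n => S.wordMap ω n 0

/-- The set `Λ(p)` of points of the carpet having a coding with digit frequencies `p`. -/
def freqSet (p : Digit m → ℝ) : Set Plane :=
  S.proj '' {ω | HasFrequencies ω p}

/-- The horizontal Lyapunov exponent of `μ`. -/
noncomputable def lyapunov (μ : Measure (ℕ → Digit m)) : ℝ :=
  -∫ ω, Real.log (S.a (ω 0)) ∂μ

/-- The vertical Lyapunov exponent of `μ`. -/
noncomputable def lyapunovV (μ : Measure (ℕ → Digit m)) : ℝ :=
  -∫ ω, Real.log (S.b (ω 0).1) ∂μ

/-- The Ledrappier–Young dimension of a shift invariant probability measure `μ` (both entropies are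
finite, since the alphabets are). -/
noncomputable def lyDim (μ : Measure (ℕ → Digit m)) : ℝ :=
  (ksEntropy μ shift).toReal / S.lyapunov μ +
    (1 / S.lyapunovV μ - 1 / S.lyapunov μ) * (ksEntropy (μ.map rowProj) shift).toReal

/-! ### The projection is well defined -/

theorem d_top (i : Fin N) : S.b i + S.d i ≤ 1 := by
  by_cases h : (i : ℕ) + 1 = N
  · exact S.d_last i h
  · have h1 := S.d_gap i ⟨i + 1, by omega⟩ rfl
    have h2 := (S.d_mem ⟨i + 1, by omega⟩).2
    linarith

theorem c_top (e : Digit m) : S.a e + S.c e ≤ 1 := by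
  obtain ⟨i, j⟩ := e
  by_cases h : (j : ℕ) + 1 = m i
  · exact S.c_last i j h
  · have h1 := S.c_gap i j ⟨j + 1, by omega⟩ rfl
    have h2 := (S.c_mem ⟨i, ⟨j + 1, by omega⟩⟩).2
    linarith

theorem map_mem_unitSquare (e : Digit m) {x : Plane} (hx : x ∈ unitSquare) :
    S.map e x ∈ unitSquare := by
  have h0 := hx 0
  have h1 := hx 1
  have ha := S.a_pos e
  have hb := (S.b_mem e.1).1
  have hc := S.c_top e
  have hd := S.d_top e.1
  have hc' := (S.c_mem e).1
  have hd' := (S.d_mem e.1).1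
  intro k
  fin_cases k
  · simp only [map, mem_Icc] at *
    constructor
    · simpa using by nlinarith [mul_nonneg ha.le h0.1]
    · simpa using by nlinarith [mul_le_mul_of_nonneg_left h0.2 ha.le]
  · simp only [map, mem_Icc] at *
    constructor
    · simpa using by nlinarith [mul_nonneg hb h1.1]
    · simpa using by nlinarith [mul_le_mul_of_nonneg_left h1.2 hb]

theorem dist_map_le (e : Digit m) (x y : Plane) :
    dist (S.map e x) (S.map e y) ≤ S.b e.1 * dist x y := by
  have hb := (S.b_mem e.1).1
  have ha := S.a_pos e
  have hab := S.a_le_b e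
  rw [EuclideanSpace.dist_eq, EuclideanSpace.dist_eq, ← Real.sqrt_sq hb,
    ← Real.sqrt_mul (sq_nonneg _)]
  apply Real.sqrt_le_sqrt
  simp only [map, Fin.sum_univ_two, Real.dist_eq, sq_abs]
  have h2 : S.a e ^ 2 ≤ S.b e.1 ^ 2 := by gcongr
  have := mul_le_mul_of_nonneg_right h2 (sq_nonneg (x 0 - y 0))
  simp
  nlinarith

theorem exists_ratio (S : LGSystem m) : ∃ r : ℝ, 0 ≤ r ∧ r < 1 ∧ ∀ e : Digit m, S.b e.1 ≤ r := by
  rcases isEmpty_or_nonempty (Digit m) with h | h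
  · exact ⟨0, le_rfl, one_pos, fun e => h.elim e⟩
  · obtain ⟨e, he⟩ := Finite.exists_max fun e : Digit m => S.b e.1
    exact ⟨S.b e.1, (S.b_mem e.1).1, S.b_lt_one e, he⟩

theorem dist_wordMap_le {r : ℝ} (hr0 : 0 ≤ r) (hr : ∀ e : Digit m, S.b e.1 ≤ r)
    (ω : ℕ → Digit m) (n : ℕ) (x y : Plane) :
    dist (S.wordMap ω n x) (S.wordMap ω n y) ≤ r ^ n * dist x y := by
  induction n generalizing x y with
  | zero => simp [wordMap]
  | succ n ih =>
    refine (ih _ _).trans ?_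
    rw [pow_succ, mul_assoc]
    gcongr
    exact (S.dist_map_le _ x y).trans (by gcongr; exact hr _)

theorem wordMap_mem_image (ω : ℕ → Digit m) {x : Plane} (hx : x ∈ unitSquare) (n k : ℕ) :
    S.wordMap ω (n + k) x ∈ S.wordMap ω n '' unitSquare := by
  induction k generalizing x with
  | zero => exact ⟨x, hx, rfl⟩
  | succ k ih => exact ih (S.map_mem_unitSquare _ hx)

theorem isCompact_unitSquare : IsCompact unitSquare := by
  have h : unitSquare = (EuclideanSpace.equiv (Fin 2) ℝ).toHomeomorph ⁻¹'
      (Set.pi univ fun _ => Icc (0 : ℝ) 1) := by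
    ext x
    simp only [unitSquare, mem_ofPred_eq, mem_preimage, mem_univ_pi]
    rfl
  rw [h, Homeomorph.isCompact_preimage]
  exact isCompact_univ_pi fun _ => isCompact_Icc

theorem zero_mem_unitSquare : (0 : Plane) ∈ unitSquare := fun k => by simp

/-- The nested rectangles `S_{ω|n}([0,1]²)` have exactly one common point, namely `S.proj ω`. -/
theorem iInter_wordMap_unitSquare (ω : ℕ → Digit m) :
    ⋂ n, S.wordMap ω n '' unitSquare = {S.proj ω} := by
  obtain ⟨r, hr0, hr1, hr⟩ := S.exists_ratio
  have hL := S.dist_wordMap_le hr0 hr ω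
  obtain ⟨C, hC⟩ := isCompact_unitSquare.isBounded.exists_norm_le
  have hC0 : 0 ≤ C := (norm_nonneg _).trans (hC 0 zero_mem_unitSquare)
  have hclose : ∀ n, ∀ x ∈ S.wordMap ω n '' unitSquare,
      dist (S.wordMap ω n 0) x ≤ C * r ^ n := by
    rintro n _ ⟨y, hy, rfl⟩
    refine (hL n 0 y).trans ?_
    rw [dist_zero_left, mul_comm]
    gcongr
    exact hC y hy
  have hcauchy : CauchySeq fun n => S.wordMap ω n 0 :=
    cauchySeq_of_le_geometric r C hr1 fun n =>
      hclose n _ (S.wordMap_mem_image ω zero_mem_unitSquare n 1)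
  have hlim : Tendsto (fun n => S.wordMap ω n 0) atTop (𝓝 (S.proj ω)) := CauchySeq.tendsto_limUnder hcauchy
  have hcont : ∀ n, Continuous (S.wordMap ω n) := fun n =>
    (LipschitzWith.of_dist_le_mul (K := ⟨r ^ n, pow_nonneg hr0 n⟩) (hL n)).continuous
  apply Subset.antisymm
  · intro x hx
    rw [mem_iInter] at hx
    have h0 : Tendsto (fun n => C * r ^ n) atTop (𝓝 0) := by
      simpa using (tendsto_pow_atTop_nhds_zero_of_lt_one hr0 hr1).const_mul C
    have hx' : Tendsto (fun n => S.wordMap ω n 0) atTop (𝓝 x) :=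
      tendsto_iff_dist_tendsto_zero.2
        (squeeze_zero (fun _ => dist_nonneg) (fun n => hclose n x (hx n)) h0)
    exact tendsto_nhds_unique hx' hlim
  · rw [singleton_subset_iff, mem_iInter]
    intro n
    refine (isCompact_unitSquare.image (hcont n)).isClosed.mem_of_tendsto hlim ?_
    filter_upwards [eventually_ge_atTop n] with k hk
    obtain ⟨l, rfl⟩ := Nat.exists_eq_add_of_le hk
    exact S.wordMap_mem_image ω zero_mem_unitSquare n l

end LGSystem

end LalleyGatzouras

namespace LalleyGatzouras

/-! ### Entropy of finite partitions -/

section PartitionEntropy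

/-! The proof computes local dimensions of Bernoulli measures along approximate squares. Fix a
coding ω and a size r. Let A be the first time at which the product of the horizontal ratios is at
most r, and B ≥ A the same for the vertical ratios. The approximate square at ω consists of the
sequences that share the first A digits and the first B rows of ω; its image has diameter at most
2r. A Bernoulli measure with weights w gives it mass ∏_{k<A} w(ω_k) · ∏_{A≤k<B} (row weight of ω_k)
(`bernoulli_key_preimage`). If ω has frequencies p, then A ~ -log r / λ and B ~ -log r / λ^v
(`tendsto_stop_div_log`), so log mass / log r converges to `crossDim p w`
(`tendsto_log_bernoulli_div_log`). For w = p this limit is D_LY, because the entropy of a Bernoulli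
shift is the Shannon entropy of its weights (`ksEntropy_infinitePi`, `lyDim_bernoulli`).

Upper bound: the approximate squares of one size are disjoint as sets of codings, so their masses
sum to at most 1, and they serve directly as a cover (`dimH_image_le_of_rpow_le`). A digit with p_e
= 0 may still occur in ω, with frequency zero, and then the p-mass vanishes. Hence strictly positive
weights w ≥ t p are used; they cost at most -log t / λ^v in dimension (`crossDim_le_of_mul_le`), and
t tends to 1.

Lower bound: by the strong law almost every ω for the weights p has frequencies p. A set of diameter
r meets boundedly many approximate squares of size r (`exists_card_key_le`, by comparing areas), so
the mass distribution principle applies to the projected measure (`le_dimH_freqSet`). -/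

theorem negMulLog_sum_le {α : Type*} (s : Finset α) (x : α → ℝ) (hx : ∀ i ∈ s, 0 ≤ x i) :
    Real.negMulLog (∑ i ∈ s, x i) ≤ ∑ i ∈ s, Real.negMulLog (x i) := by
  rw [Real.negMulLog, ← Finset.sum_neg_distrib, Finset.sum_mul]
  refine Finset.sum_le_sum fun i hi => ?_
  rcases (hx i hi).eq_or_lt with h | h
  · simp [← h]
  · rw [Real.negMulLog, neg_mul, neg_mul, neg_le_neg_iff]
    exact mul_le_mul_of_nonneg_left
      (Real.log_le_log h (Finset.single_le_sum hx hi)) h.le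

theorem measurable_itinerary {X ι : Type*} [MeasurableSpace X] [MeasurableSpace ι] {T : X → X}
    (hT : Measurable T) {f : X → ι} (hf : Measurable f) (n : ℕ) :
    Measurable (itinerary T f n) :=
  measurable_pi_lambda _ fun l => hf.comp (hT.iterate l)

variable {X ι κ : Type*} [MeasurableSpace X] [Fintype ι] [MeasurableSpace ι]
  [MeasurableSingletonClass ι]

theorem measureReal_comp_preimage_singleton [DecidableEq κ] (μ : Measure X) [IsFiniteMeasure μ]
    {f : X → ι} (hf : Measurable f) (φ : ι → κ) (j : κ) :
    μ.real ((φ ∘ f) ⁻¹' {j}) = ∑ i with φ i = j, μ.real (f ⁻¹' {i}) := by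
  rw [← measureReal_biUnion_finset]
  · congr 1
    ext x
    simp
  · intro i _ i' _ h
    exact Disjoint.preimage f (by simpa using h)
  · exact fun i _ => hf (measurableSet_singleton i)

theorem sum_measureReal_preimage_singleton (μ : Measure X) [IsProbabilityMeasure μ]
    {f : X → ι} (hf : Measurable f) : ∑ i, μ.real (f ⁻¹' {i}) = 1 := by
  have h := measureReal_comp_preimage_singleton μ hf (fun _ => ()) ()
  simpa [Function.comp_def] using h.symm

variable [Fintype κ]

theorem partitionEntropy_comp_le (μ : Measure X) [IsFiniteMeasure μ] {f : X → ι}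
    (hf : Measurable f) (φ : ι → κ) : partitionEntropy μ (φ ∘ f) ≤ partitionEntropy μ f := by
  classical
  unfold partitionEntropy
  rw [← Finset.sum_fiberwise (s := Finset.univ) (g := φ)]
  refine Finset.sum_le_sum fun j _ => ?_
  rw [measureReal_comp_preimage_singleton μ hf]
  exact negMulLog_sum_le _ _ fun _ _ => measureReal_nonneg

theorem partitionEntropy_le_of_factors [Nonempty X] (μ : Measure X) [IsFiniteMeasure μ] {f : X → ι}
    (hf : Measurable f) {g : X → κ} (h : ∀ x y, f x = f y → g x = g y) :
    partitionEntropy μ g ≤ partitionEntropy μ f := by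
  obtain ⟨x₀⟩ := ‹Nonempty X›
  have hg : Function.FactorsThrough g f := fun x y => h x y
  -- `g x₀` is only a default value off the range of `f`.
  have h2 : g = Function.extend f g (fun _ => g x₀) ∘ f := by
    ext x
    exact (hg.extend_apply _ x).symm
  rw [h2]
  exact partitionEntropy_comp_le μ hf _

variable [MeasurableSpace κ] [MeasurableSingletonClass κ]

theorem partitionEntropy_prodMk_le (μ : Measure X) [IsProbabilityMeasure μ] {f : X → ι}
    {g : X → κ} (hf : Measurable f) (hg : Measurable g) :
    partitionEntropy μ (fun x => (f x, g x)) ≤ partitionEntropy μ f + partitionEntropy μ g := by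
  classical
  have hfg : Measurable fun x => (f x, g x) := hf.prodMk hg
  set P : ι → κ → ℝ := fun i j => μ.real ((fun x => (f x, g x)) ⁻¹' {(i, j)}) with hP
  set p : ι → ℝ := fun i => μ.real (f ⁻¹' {i}) with hp
  set q : κ → ℝ := fun j => μ.real (g ⁻¹' {j}) with hq
  have hP0 : ∀ i j, 0 ≤ P i j := fun _ _ => measureReal_nonneg
  have hPp : ∀ i j, P i j ≤ p i := fun i j =>
    measureReal_mono fun x hx => by simp_all
  have hPq : ∀ i j, P i j ≤ q j := fun i j =>
    measureReal_mono fun x hx => by simp_all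
  have hp1 : ∀ i, ∑ j, P i j = p i := fun i => by
    have := measureReal_comp_preimage_singleton μ hfg Prod.fst i
    rw [Finset.sum_filter, Fintype.sum_prod_type, Finset.sum_eq_single i] at this
    · simpa [hP, hp, Function.comp_def] using this.symm
    · intro b _ hb
      simp [hb]
    · simp
  have hq1 : ∀ j, ∑ i, P i j = q j := fun j => by
    have := measureReal_comp_preimage_singleton μ hfg Prod.snd j
    rw [Finset.sum_filter, Fintype.sum_prod_type_right, Finset.sum_eq_single j] at this
    · simpa [hP, hq, Function.comp_def] using this.symm
    · intro b _ hb
      simp [hb]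
    · simp
  have hps : ∑ i, p i = 1 := sum_measureReal_preimage_singleton μ hf
  have hqs : ∑ j, q j = 1 := sum_measureReal_preimage_singleton μ hg
  -- This is log t ≤ t - 1 at t = p q / P, multiplied by P. The corrections p q - P sum to 1 - 1 =
  -- 0.
  have key : ∀ i j, Real.negMulLog (P i j) ≤
      -(P i j * Real.log (p i)) - P i j * Real.log (q j) + (p i * q j - P i j) := by
    intro i j
    rcases (hP0 i j).eq_or_lt with h | h
    · rw [← h]
      simpa using mul_nonneg measureReal_nonneg measureReal_nonneg
    · have h1 := h.trans_le (hPp i j)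
      have h2 := h.trans_le (hPq i j)
      have h3 := Real.log_le_sub_one_of_pos (div_pos (mul_pos h1 h2) h)
      rw [Real.log_div (mul_pos h1 h2).ne' h.ne', Real.log_mul h1.ne' h2.ne'] at h3
      have h4 := mul_le_mul_of_nonneg_left h3 h.le
      have h5 : P i j * (p i * q j / P i j - 1) = p i * q j - P i j := by
        field_simp
      rw [h5] at h4
      rw [Real.negMulLog]
      linarith
  have hH : partitionEntropy μ (fun x => (f x, g x)) = ∑ i, ∑ j, Real.negMulLog (P i j) := by
    rw [partitionEntropy, Fintype.sum_prod_type]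
  rw [hH]
  refine (Finset.sum_le_sum fun i _ => Finset.sum_le_sum fun j _ => key i j).trans ?_
  simp only [Finset.sum_add_distrib, Finset.sum_sub_distrib, Finset.sum_neg_distrib]
  have e1 : ∑ i, ∑ j, P i j * Real.log (p i) = -partitionEntropy μ f := by
    simp only [← Finset.sum_mul, hp1, partitionEntropy, Real.negMulLog, neg_mul,
      Finset.sum_neg_distrib, neg_neg, hp]
  have e2 : ∑ i, ∑ j, P i j * Real.log (q j) = -partitionEntropy μ g := by
    rw [Finset.sum_comm]
    simp only [← Finset.sum_mul, hq1, partitionEntropy, Real.negMulLog, neg_mul,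
      Finset.sum_neg_distrib, neg_neg, hq]
  have e3 : ∑ i, ∑ j, p i * q j = 1 := by
    simp only [← Finset.mul_sum, hqs, mul_one, hps]
  have e4 : ∑ i, ∑ j, P i j = 1 := by
    simp only [hp1, hps]
  rw [e1, e2, e3, e4]
  linarith

theorem partitionEntropy_pi_le [Nonempty X] (μ : Measure X) [IsProbabilityMeasure μ] {n : ℕ}
    {F : Fin n → X → ι} (hF : ∀ l, Measurable (F l)) :
    partitionEntropy μ (fun x l => F l x) ≤ ∑ l, partitionEntropy μ (F l) := by
  induction n with
  | zero =>
    have : ∀ w : Fin 0 → ι, (fun x l => F l x) ⁻¹' {w} = (univ : Set X) := fun w => by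
      ext x
      simp only [mem_preimage, mem_singleton_iff, mem_univ, iff_true]
      exact Subsingleton.elim _ _
    simp [partitionEntropy, this]
  | succ n ih =>
    have h0 : Measurable fun x (l : Fin n) => F l.succ x :=
      measurable_pi_lambda _ fun l => hF l.succ
    calc partitionEntropy μ (fun x l => F l x)
        ≤ partitionEntropy μ (fun x => (F 0 x, fun l : Fin n => F l.succ x)) := by
          refine partitionEntropy_le_of_factors μ ((hF 0).prodMk h0) fun x y hxy => ?_
          rw [Prod.mk.injEq] at hxy
          ext l
          refine Fin.cases hxy.1 (fun l => congrFun hxy.2 l) l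
      _ ≤ _ := partitionEntropy_prodMk_le μ (hF 0) h0
      _ ≤ _ := by
          rw [Fin.sum_univ_succ]
          gcongr
          exact ih fun l => hF l.succ

theorem partitionEntropy_comp_measurePreserving {μ : Measure X} {T : X → X}
    (hT : MeasurePreserving T μ μ) {f : X → ι} (hf : Measurable f) :
    partitionEntropy μ (f ∘ T) = partitionEntropy μ f := by
  unfold partitionEntropy
  refine Finset.sum_congr rfl fun i _ => ?_
  rw [preimage_comp, hT.measureReal_preimage (hf (measurableSet_singleton i)).nullMeasurableSet]

theorem partitionEntropy_bool (μ : Measure X) [IsProbabilityMeasure μ] {f : X → Bool}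
    (hf : Measurable f) : partitionEntropy μ f = Real.binEntropy (μ.real (f ⁻¹' {true})) := by
  have h := sum_measureReal_preimage_singleton μ hf
  rw [Fintype.sum_bool] at h
  rw [partitionEntropy, Fintype.sum_bool, Real.binEntropy_eq_negMulLog_add_negMulLog_one_sub, ← h]
  congr 2
  ring

theorem partitionEntropy_itinerary_le [Nonempty X] {μ : Measure X} [IsProbabilityMeasure μ]
    {T : X → X} (hT : MeasurePreserving T μ μ) {f : X → ι} (hf : Measurable f) (n : ℕ) :
    partitionEntropy μ (itinerary T f n) ≤ n * partitionEntropy μ f := by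
  refine (partitionEntropy_pi_le μ (F := fun l x => f (T^[l] x))
    fun l => hf.comp (hT.measurable.iterate l)).trans (le_of_eq ?_)
  have : ∀ l : Fin n, partitionEntropy μ (fun x => f (T^[l] x)) = partitionEntropy μ f :=
    fun l => partitionEntropy_comp_measurePreserving (hT.iterate l) hf
  simp [this]

end PartitionEntropy

/-! ### Entropy of Bernoulli shifts -/

section BernoulliEntropy

open Measure

theorem shift_iterate {A : Type*} (l : ℕ) (ω : ℕ → A) : shift^[l] ω = fun n => ω (n + l) := by
  induction l generalizing ω with
  | zero => rfl
  | succ l ih =>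
    rw [Function.iterate_succ_apply, ih]
    ext n
    simp only [shift]
    congr 1

theorem measurePreserving_shift {A : Type*} [MeasurableSpace A] (ν : Measure A)
    [IsProbabilityMeasure ν] :
    MeasurePreserving shift (infinitePi fun _ : ℕ => ν) (infinitePi fun _ : ℕ => ν) := by
  refine ⟨measurable_pi_lambda _ fun n => measurable_pi_apply (n + 1), ?_⟩
  exact map_infinitePi_infinitePi_of_inj (P := fun _ : ℕ => ν) (add_left_injective 1)

/-- Entropy is additive over independent coordinates: negMulLog (x y) = y negMulLog x + x negMulLog
y, and each marginal sums to 1. -/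
theorem sum_negMulLog_prod {A : Type*} [Fintype A] (q : A → ℝ) (hq : ∑ a, q a = 1) (n : ℕ) :
    ∑ w : Fin n → A, Real.negMulLog (∏ l, q (w l)) = n * ∑ a, Real.negMulLog (q a) := by
  induction n with
  | zero => simp
  | succ n ih =>
    have h1 : ∑ w : Fin n → A, ∏ l, q (w l) = 1 := by
      rw [← Fintype.sum_pow, hq, one_pow]
    rw [← (Fin.consEquiv fun _ => A).sum_comp, Fintype.sum_prod_type]
    simp only [Fin.consEquiv_apply, Fin.prod_univ_succ, Fin.cons_zero, Fin.cons_succ,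
      Real.negMulLog_mul, Finset.sum_add_distrib]
    simp only [← Finset.mul_sum, ← Finset.sum_mul, ih, h1, hq]
    push_cast
    ring

theorem infinitePi_real_cylinder {A : Type*} [MeasurableSpace A] [MeasurableSingletonClass A]
    (ν : Measure A) [IsProbabilityMeasure ν] (n : ℕ) (w : Fin n → A) :
    (infinitePi fun _ : ℕ => ν).real ((fun (ω : ℕ → A) (l : Fin n) => ω l) ⁻¹' {w}) =
      ∏ l, ν.real {w l} := by
  have h : (fun (ω : ℕ → A) (l : Fin n) => ω l) ⁻¹' {w} =
      Set.pi (Finset.range n) fun k => if h : k < n then {w ⟨k, h⟩} else univ := by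
    ext ω
    simp only [mem_preimage, mem_singleton_iff, Finset.coe_range, Set.mem_pi]
    constructor
    · rintro rfl k hk
      simp
    · intro h
      ext l
      simpa using h l l.2
  rw [h, measureReal_def, infinitePi_pi, Finset.prod_range, ENNReal.toReal_prod]
  · simp [measureReal_def]
  · intro k hk
    split_ifs <;> simp

/-- Cylinders form a ring of sets that generates the product σ-algebra, so they are dense for the
measure of the symmetric difference. The bound `L` is one more than the largest coordinate on which
the chosen cylinder depends. -/
theorem exists_cylinder_approx {A : Type*} [MeasurableSpace A] (ν : Measure A)
    [IsProbabilityMeasure ν] {s : Set (ℕ → A)}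
    (hs : MeasurableSet s) {δ : ℝ} (hδ : 0 < δ) :
    ∃ (t : Set (ℕ → A)) (L : ℕ), MeasurableSet t ∧
      (∀ ω τ : ℕ → A, (∀ l < L, ω l = τ l) → (ω ∈ t ↔ τ ∈ t)) ∧
      (infinitePi fun _ : ℕ => ν).real (symmDiff t s) < δ := by
  obtain ⟨t, ht, h⟩ := exists_measure_symmDiff_lt_of_generateFrom_isSetRing
    (μ := infinitePi fun _ : ℕ => ν) (C := measurableCylinders fun _ : ℕ => A)
    isSetRing_measurableCylinders
    ⟨{univ}, by simp, singleton_subset_iff.2 (univ_mem_measurableCylinders _), by simp⟩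
    generateFrom_measurableCylinders.symm hs (ENNReal.ofReal_pos.2 hδ)
  obtain ⟨I, S, hS, rfl⟩ := (mem_measurableCylinders t).1 ht
  refine ⟨cylinder I S, I.sup id + 1, hS.cylinder I, fun ω τ hωτ => ?_, ?_⟩
  · have : I.restrict ω = I.restrict τ := by
      ext i
      exact hωτ i (Nat.lt_succ_of_le (Finset.le_sup (f := id) i.2))
    simp only [mem_cylinder, this]
  · rw [measureReal_def]
    exact (ENNReal.toReal_lt_of_lt_ofReal h)

variable {A : Type*} [Fintype A] [MeasurableSpace A] [MeasurableSingletonClass A]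

theorem partitionEntropy_itinerary_eval (ν : Measure A) [IsProbabilityMeasure ν] (n : ℕ) :
    partitionEntropy (infinitePi fun _ : ℕ => ν) (fun (ω : ℕ → A) (l : Fin n) => ω l) =
      n * ∑ a, Real.negMulLog (ν.real {a}) := by
  simp only [partitionEntropy, infinitePi_real_cylinder]
  refine sum_negMulLog_prod (fun a => ν.real {a}) ?_ n
  simp

/-- Each cell of `f` is approximated by a set `t i` depending on at most `L` symbols. The first n +
L symbols decide all memberships in the sets `t i` at times l < n; together with the itinerary of
the error indicators `e` they determine the itinerary of `f`. The errors have small probability,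
hence entropy at most ε per time step. -/
theorem exists_partitionEntropy_itinerary_le (ν : Measure A) [IsProbabilityMeasure ν] {k : ℕ}
    {f : (ℕ → A) → Fin k} (hf : Measurable f) {ε : ℝ} (hε : 0 < ε) :
    ∃ L : ℕ, ∀ n : ℕ, partitionEntropy (infinitePi fun _ : ℕ => ν) (itinerary shift f n) ≤
      (n + L : ℕ) * ∑ a, Real.negMulLog (ν.real {a}) + n * ε := by
  classical
  have : Nonempty A := nonempty_of_isProbabilityMeasure ν
  set μ := infinitePi fun _ : ℕ => ν
  have hT := measurePreserving_shift ν
  -- Continuity of the binary entropy at 0; the factor k allows for one error indicator per cell.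
  obtain ⟨δ, hδ, hδε⟩ : ∃ δ > 0, ∀ x : ℝ, |x| < δ → k * Real.binEntropy x < ε := by
    have h : Continuous fun x => k * Real.binEntropy x := by fun_prop
    have h2 := h.tendsto 0
    simp only [Real.binEntropy_zero, mul_zero] at h2
    obtain ⟨δ, hδ, h3⟩ := Metric.eventually_nhds_iff.1 (h2.eventually_lt_const hε)
    exact ⟨δ, hδ, fun x hx => h3 (by simpa using hx)⟩
  have hk : 0 < k := (f fun _ => Classical.arbitrary A).pos
  choose t M htm hts htδ using fun i : Fin k =>
    exists_cylinder_approx ν (hf (measurableSet_singleton i)) hδ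
  set L := Finset.univ.sup M
  have hML : ∀ i, M i ≤ L := fun i => Finset.le_sup (Finset.mem_univ i)
  refine ⟨L, fun n => ?_⟩
  set g : (ℕ → A) → Fin k → Bool := fun x i => decide (x ∈ t i)
  set e : Fin k → (ℕ → A) → Bool := fun i x => decide (x ∈ symmDiff (t i) (f ⁻¹' {i}))
  have he : ∀ i, Measurable (e i) := fun i =>
    measurable_to_bool (by
      have : e i ⁻¹' {true} = symmDiff (t i) (f ⁻¹' {i}) := by ext x; simp [e]
      rw [this]
      exact (htm i).symmDiff (hf (measurableSet_singleton i)))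
  have he' : Measurable fun x i => e i x := measurable_pi_lambda _ he
  have hcyl : Measurable fun (ω : ℕ → A) (l : Fin (n + L)) => ω l :=
    measurable_pi_lambda _ fun l => measurable_pi_apply _
  have hHe : partitionEntropy μ (fun x i => e i x) ≤ ε := by
    refine (partitionEntropy_pi_le μ he).trans ?_
    have h1 : ∀ i, partitionEntropy μ (e i) ≤ ε / k := fun i => by
      rw [partitionEntropy_bool μ (he i)]
      have : e i ⁻¹' {true} = symmDiff (t i) (f ⁻¹' {i}) := by ext x; simp [e]
      rw [this, le_div_iff₀ (by exact_mod_cast hk), mul_comm]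
      refine (hδε _ ?_).le
      rw [abs_of_nonneg measureReal_nonneg]
      exact htδ i
    refine (Finset.sum_le_sum fun i _ => h1 i).trans (le_of_eq ?_)
    have : (k : ℝ) ≠ 0 := by exact_mod_cast hk.ne'
    simp
    field_simp
  calc partitionEntropy μ (itinerary shift f n)
      ≤ partitionEntropy μ (fun ω => ((fun l : Fin (n + L) => ω l),
          itinerary shift (fun x i => e i x) n ω)) := by
        refine partitionEntropy_le_of_factors μ
          (hcyl.prodMk (measurable_itinerary hT.measurable he' n)) fun ω τ h => ?_
        rw [Prod.mk.injEq] at h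
        ext1 l
        have h2 := congrFun h.2 l
        simp only [itinerary, shift_iterate] at h2 ⊢
        have h1 : ∀ i, (fun j => ω (j + l)) ∈ t i ↔ (fun j => τ (j + l)) ∈ t i := fun i =>
          hts i _ _ fun j hj => congrFun h.1 ⟨j + l, by have := hML i; omega⟩
        -- Only the cell i that contains the shifted ω needs testing: equal membership in `t i` and
        -- equal error indicators force equal membership in the cell.
        have h3 := congrFun h2 (f fun j => ω (j + l))
        simp only [e, decide_eq_decide, mem_symmDiff, h1, mem_preimage, mem_singleton_iff] at h3
        by_contra hne
        have hne' := Ne.symm hne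
        simp only [hne', not_true_eq_false] at h3
        tauto
    _ ≤ _ := partitionEntropy_prodMk_le μ hcyl (measurable_itinerary hT.measurable he' n)
    _ ≤ _ := by
        rw [partitionEntropy_itinerary_eval]
        gcongr
        exact (partitionEntropy_itinerary_le hT he' n).trans (by gcongr)

/-- The Kolmogorov–Sinai entropy of a Bernoulli shift is the Shannon entropy of its weights. -/
theorem ksEntropy_infinitePi (ν : Measure A) [IsProbabilityMeasure ν] :
    ksEntropy (infinitePi fun _ : ℕ => ν) shift =
      ENNReal.ofReal (∑ a, Real.negMulLog (ν.real {a})) := by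
  have : Nonempty A := nonempty_of_isProbabilityMeasure ν
  set H := ∑ a, Real.negMulLog (ν.real {a}) with hH
  set μ := infinitePi fun _ : ℕ => ν
  apply le_antisymm
  · refine iSup_le fun k => iSup₂_le fun f hf => ?_
    refine ENNReal.le_of_forall_pos_le_add fun ε hε _ => ?_
    obtain ⟨L, hL⟩ := exists_partitionEntropy_itinerary_le ν hf (NNReal.coe_pos.2 hε)
    have hlim : Tendsto (fun n : ℕ => ENNReal.ofReal (H + ε + L * H / n)) atTop
        (𝓝 (ENNReal.ofReal (H + ε + 0))) :=
      (ENNReal.continuous_ofReal.tendsto _).comp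
        (tendsto_const_nhds.add (tendsto_const_div_atTop_nhds_zero_nat _))
    have hle : entropyRel μ shift f ≤ ENNReal.ofReal (H + ε + 0) := by
      rw [← hlim.limsup_eq]
      refine limsup_le_limsup ?_
      filter_upwards [eventually_gt_atTop 0] with n hn
      apply ENNReal.ofReal_le_ofReal
      have hn' : (0 : ℝ) < n := by exact_mod_cast hn
      rw [div_le_iff₀ hn']
      refine (hL n).trans (le_of_eq ?_)
      push_cast
      field_simp
      ring
    refine hle.trans ?_
    rw [add_zero]
    refine ENNReal.ofReal_add_le.trans ?_
    simp
  -- The partition by the symbol at time 0 attains the supremum: its n-itinerary determines the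
  -- first n symbols.
  · let φ := Fintype.equivFin A
    have hφ : Measurable fun ω : ℕ → A => φ (ω 0) :=
      (measurable_of_finite φ).comp (measurable_pi_apply 0)
    refine le_trans ?_ (le_iSup_of_le (Fintype.card A) (le_iSup₂_of_le _ hφ le_rfl))
    have hconst : Tendsto (fun _ : ℕ => ENNReal.ofReal H) atTop (𝓝 (ENNReal.ofReal H)) :=
      tendsto_const_nhds
    rw [← hconst.limsup_eq, entropyRel]
    refine limsup_le_limsup ?_
    filter_upwards [eventually_gt_atTop 0] with n hn
    apply ENNReal.ofReal_le_ofReal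
    have hn' : (0 : ℝ) < n := by exact_mod_cast hn
    rw [le_div_iff₀ hn', mul_comm, ← partitionEntropy_itinerary_eval ν n]
    refine partitionEntropy_le_of_factors _
      (measurable_itinerary (measurePreserving_shift ν).measurable hφ n) fun ω τ h => ?_
    ext l
    have h2 := congrFun h l
    simpa [itinerary, shift_iterate] using h2

end BernoulliEntropy

/-! ### Nested intervals -/

section Intervals

/-- The length of the `n`-th of a sequence of nested intervals with successive ratios `x`. -/
def len (x : ℕ → ℝ) (n : ℕ) : ℝ := ∏ k ∈ Finset.range n, x k

/-- The left end point of the `n`-th of a sequence of nested intervals with successive ratios `x`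
and successive relative positions `c`. -/
def off (x c : ℕ → ℝ) (n : ℕ) : ℝ := ∑ k ∈ Finset.range n, len x k * c k

/-- The first `n` for which the `n`-th interval has length at most `r`. -/
noncomputable def stopTime (x : ℕ → ℝ) (r : ℝ) : ℕ := sInf {n | len x n ≤ r}

variable {x y c d : ℕ → ℝ} {r : ℝ} {n : ℕ}

theorem len_succ (x : ℕ → ℝ) (n : ℕ) : len x (n + 1) = len x n * x n :=
  Finset.prod_range_succ _ _

theorem off_succ (x c : ℕ → ℝ) (n : ℕ) : off x c (n + 1) = off x c n + len x n * c n :=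
  Finset.sum_range_succ _ _

theorem len_pos (hx : ∀ k, 0 < x k) (n : ℕ) : 0 < len x n :=
  Finset.prod_pos fun k _ => hx k

theorem len_congr (h : ∀ k < n, x k = y k) : len x n = len y n :=
  Finset.prod_congr rfl fun k hk => h k (Finset.mem_range.1 hk)

theorem off_congr (h : ∀ k < n, x k = y k) (h' : ∀ k < n, c k = d k) : off x c n = off y d n :=
  Finset.sum_congr rfl fun k hk => by
    have hk' := Finset.mem_range.1 hk
    rw [h' k hk', len_congr fun j hj => h j (hj.trans hk')]

theorem log_len (hx : ∀ k, 0 < x k) (n : ℕ) :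
    Real.log (len x n) = ∑ k ∈ Finset.range n, Real.log (x k) :=
  Real.log_prod fun k _ => (hx k).ne'

theorem exists_len_le {q : ℝ} (hx : ∀ k, 0 < x k) (hq : ∀ k, x k ≤ q) (hq1 : q < 1) (hr : 0 < r) :
    ∃ n, len x n ≤ r := by
  have hq0 : 0 ≤ q := (hx 0).le.trans (hq 0)
  obtain ⟨n, hn⟩ := exists_pow_lt_of_lt_one hr hq1
  refine ⟨n, le_trans ?_ hn.le⟩
  calc len x n ≤ ∏ _k ∈ Finset.range n, q :=
        Finset.prod_le_prod (fun k _ => (hx k).le) fun k _ => hq k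
    _ = q ^ n := by simp

theorem len_stop_le {q : ℝ} (hx : ∀ k, 0 < x k) (hq : ∀ k, x k ≤ q) (hq1 : q < 1) (hr : 0 < r) :
    len x (stopTime x r) ≤ r :=
  Nat.sInf_mem (exists_len_le hx hq hq1 hr)

theorem lt_len_of_lt_stop (h : n < stopTime x r) : r < len x n :=
  not_le.1 (Nat.notMem_of_lt_sInf h)

theorem stop_le (h : len x n ≤ r) : stopTime x r ≤ n := Nat.sInf_le h

/-- One step before stopping the length still exceeds r, and the last ratio is at least c. If the
stopping time is 0, the length is 1. -/
theorem mul_lt_len_stop {c : ℝ} (hx : ∀ k, 0 < x k) (hx1 : x 0 < 1) (hc : ∀ k, c ≤ x k)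
    (hc0 : 0 < c) (hr1 : r < 1) : c * r < len x (stopTime x r) := by
  rcases Nat.eq_zero_or_eq_succ_pred (stopTime x r) with h | h
  · rw [h, len, Finset.prod_range_zero]
    have := mul_lt_mul_of_pos_left hr1 hc0
    linarith [hc 0]
  · rw [h, len_succ, mul_comm]
    have h1 : r < len x (stopTime x r).pred := lt_len_of_lt_stop (by omega)
    exact (mul_lt_mul_of_pos_right h1 hc0).trans_le
      (mul_le_mul_of_nonneg_left (hc _) (len_pos hx _).le)

/-- Whether the sequence has stopped by time n depends on the ratios before n alone. -/
theorem stop_congr {q : ℝ} (hx : ∀ k, 0 < x k) (hq : ∀ k, x k ≤ q) (hq1 : q < 1) (hr : 0 < r)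
    (h : ∀ k < stopTime x r, y k = x k) : stopTime y r = stopTime x r := by
  have h1 : len y (stopTime x r) ≤ r := by
    rw [len_congr h]
    exact len_stop_le hx hq hq1 hr
  refine le_antisymm (stop_le h1) ?_
  by_contra! hlt
  have h2 := lt_len_of_lt_stop hlt
  -- By `h1` the set defining `stopTime y r` is nonempty, so its infimum is attained.
  have h3 : len y (stopTime y r) ≤ r := Nat.sInf_mem (s := {n | len y n ≤ r}) ⟨_, h1⟩
  rw [len_congr fun k hk => h k (hk.trans hlt)] at h3
  linarith

theorem stop_mono {q : ℝ} (hx : ∀ k, 0 < x k) (hxy : ∀ k, x k ≤ y k) (hq : ∀ k, y k ≤ q)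
    (hq1 : q < 1) (hr : 0 < r) : stopTime x r ≤ stopTime y r :=
  stop_le ((Finset.prod_le_prod (fun k _ => (hx k).le) fun k _ => hxy k).trans
    (len_stop_le (fun k => (hx k).trans_le (hxy k)) hq hq1 hr))

theorem Ico_off_subset (hx : ∀ k, 0 < x k) (hc : ∀ k, 0 ≤ c k) (hxc : ∀ k, x k + c k ≤ 1)
    {k : ℕ} (hkn : k ≤ n) :
    Ico (off x c n) (off x c n + len x n) ⊆ Ico (off x c k) (off x c k + len x k) := by
  induction n, hkn using Nat.le_induction with
  | base => rfl
  | succ n _ ih =>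
    refine Subset.trans ?_ ih
    have h0 := len_pos hx n
    rw [off_succ, len_succ]
    apply Ico_subset_Ico
    · have := mul_nonneg h0.le (hc n)
      linarith
    · nlinarith [mul_le_mul_of_nonneg_left (hxc n) h0.le]

/-- Intervals of two sequences of nested intervals, driven by the symbols `u` and `v`, are disjoint
once the symbols differ. -/
theorem disjoint_Ico_stop {ι : Type*} {ρ γ : ι → ℝ} {u v : ℕ → ι} {q : ℝ}
    (hρu : ∀ k, 0 < ρ (u k)) (hρv : ∀ k, 0 < ρ (v k)) (hγ : ∀ i, 0 ≤ γ i)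
    (hργ : ∀ i, ρ i + γ i ≤ 1) (hq : ∀ k, ρ (v k) ≤ q)
    (hq1 : q < 1) (hr : 0 < r) (hne : ∃ k < stopTime (ρ ∘ u) r, u k ≠ v k)
    (hd : ∀ k < stopTime (ρ ∘ u) r, u k ≠ v k →
      Disjoint (Ico (γ (u k)) (γ (u k) + ρ (u k))) (Ico (γ (v k)) (γ (v k) + ρ (v k)))) :
    Disjoint
      (Ico (off (ρ ∘ u) (γ ∘ u) (stopTime (ρ ∘ u) r))
        (off (ρ ∘ u) (γ ∘ u) (stopTime (ρ ∘ u) r) + len (ρ ∘ u) (stopTime (ρ ∘ u) r)))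
      (Ico (off (ρ ∘ v) (γ ∘ v) (stopTime (ρ ∘ v) r))
        (off (ρ ∘ v) (γ ∘ v) (stopTime (ρ ∘ v) r) + len (ρ ∘ v) (stopTime (ρ ∘ v) r))) := by
  classical
  obtain ⟨hk, hkne⟩ := Nat.find_spec hne
  have hmin : ∀ j < Nat.find hne, u j = v j := fun j hj => by
    by_contra h
    exact Nat.find_min hne hj ⟨hj.trans hk, h⟩
  set k := Nat.find hne
  -- Had `v` stopped by the first disagreement k, `u` would have stopped at the same time, contrary
  -- to `hk`.
  have hk' : k < stopTime (ρ ∘ v) r := by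
    by_contra! hle
    have := stop_congr (x := ρ ∘ v) (y := ρ ∘ u) hρv hq hq1 hr fun j hj => by
      simp [hmin j (hj.trans_le hle)]
    omega
  refine Disjoint.mono
    (Ico_off_subset (x := ρ ∘ u) (c := γ ∘ u) hρu
      (fun j => hγ _) (fun j => hργ _) (Nat.succ_le_of_lt hk))
    (Ico_off_subset (x := ρ ∘ v) (c := γ ∘ v) hρv
      (fun j => hγ _) (fun j => hργ _) (Nat.succ_le_of_lt hk')) ?_
  have e1 : len (ρ ∘ u) k = len (ρ ∘ v) k := len_congr fun j hj => by simp [hmin j hj]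
  have e2 : off (ρ ∘ u) (γ ∘ u) k = off (ρ ∘ v) (γ ∘ v) k :=
    off_congr (fun j hj => by simp [hmin j hj]) fun j hj => by simp [hmin j hj]
  have hL := len_pos (x := ρ ∘ v) hρv k
  have hdk := hd k hk hkne
  rw [Set.disjoint_left] at hdk ⊢
  intro z hz1 hz2
  rw [Nat.succ_eq_add_one, off_succ, len_succ, mem_Ico, Function.comp_apply,
    Function.comp_apply] at hz1 hz2
  rw [e1, e2] at hz1
  -- Both intervals lie in the same parent interval of generation k; rescaling it to the unit
  -- interval reduces to first-level intervals.
  refine hdk (a := (z - off (ρ ∘ v) (γ ∘ v) k) / len (ρ ∘ v) k) ?_ ?_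
  · rw [mem_Ico, le_div_iff₀ hL, div_lt_iff₀ hL]
    constructor <;> nlinarith
  · rw [mem_Ico, le_div_iff₀ hL, div_lt_iff₀ hL]
    constructor <;> nlinarith

end Intervals

namespace LGSystem

variable {N : ℕ} {m : Fin N → ℕ} (S : LGSystem m)

/-! ### Approximate squares -/

theorem b_pos (e : Digit m) : 0 < S.b e.1 := (S.a_pos e).trans_le (S.a_le_b e)

/-- Horizontal ratios along `ω`. -/
def ratioA (ω : ℕ → Digit m) : ℕ → ℝ := S.a ∘ ω

/-- Vertical ratios along `ω`. -/
def ratioB (ω : ℕ → Digit m) : ℕ → ℝ := S.b ∘ rowProj ω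

/-- The number of digits that determine the columns of the approximate square of size `r`. -/
noncomputable def stopA (r : ℝ) (ω : ℕ → Digit m) : ℕ := stopTime (S.ratioA ω) r

/-- The number of rows that determine the approximate square of size `r`. -/
noncomputable def stopB (r : ℝ) (ω : ℕ → Digit m) : ℕ := stopTime (S.ratioB ω) r

/-- The code of the approximate square of size `r` that contains `ω`. -/
noncomputable def key (r : ℝ) (ω : ℕ → Digit m) : List (Digit m) × List (Fin N) :=
  ((List.range (S.stopA r ω)).map ω, (List.range (S.stopB r ω)).map (rowProj ω))

/-- The approximate square of size `r` that contains `ω`, without its upper and right sides. -/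
noncomputable def rect (r : ℝ) (ω : ℕ → Digit m) : Set (ℝ × ℝ) :=
  Ico (off (S.ratioA ω) (S.c ∘ ω) (S.stopA r ω))
      (off (S.ratioA ω) (S.c ∘ ω) (S.stopA r ω) + len (S.ratioA ω) (S.stopA r ω)) ×ˢ
    Ico (off (S.ratioB ω) (S.d ∘ rowProj ω) (S.stopB r ω))
      (off (S.ratioB ω) (S.d ∘ rowProj ω) (S.stopB r ω) + len (S.ratioB ω) (S.stopB r ω))

variable {S} {r : ℝ}

theorem ratioA_pos (ω : ℕ → Digit m) (k : ℕ) : 0 < S.ratioA ω k := S.a_pos _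

theorem ratioB_pos (ω : ℕ → Digit m) (k : ℕ) : 0 < S.ratioB ω k := S.b_pos _

theorem ratioA_le_ratioB (ω : ℕ → Digit m) (k : ℕ) : S.ratioA ω k ≤ S.ratioB ω k := S.a_le_b _

theorem stopA_le_stopB (hr : 0 < r) (ω : ℕ → Digit m) : S.stopA r ω ≤ S.stopB r ω := by
  obtain ⟨q, -, hq1, hq⟩ := S.exists_ratio
  exact stop_mono (ratioA_pos ω) (ratioA_le_ratioB ω) (fun k => hq _) hq1 hr

theorem stopA_congr (hr : 0 < r) {ω τ : ℕ → Digit m} (h : ∀ k < S.stopA r ω, τ k = ω k) :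
    S.stopA r τ = S.stopA r ω := by
  obtain ⟨q, -, hq1, hq⟩ := S.exists_ratio
  exact stop_congr (ratioA_pos ω) (fun k => (S.a_le_b _).trans (hq _)) hq1 hr fun k hk => by
    simp [ratioA, h k hk]

theorem stopB_congr (hr : 0 < r) {ω τ : ℕ → Digit m}
    (h : ∀ k < S.stopB r ω, rowProj τ k = rowProj ω k) : S.stopB r τ = S.stopB r ω := by
  obtain ⟨q, -, hq1, hq⟩ := S.exists_ratio
  exact stop_congr (ratioB_pos ω) (fun k => hq _) hq1 hr fun k hk => by simp [ratioB, h k hk]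

/-- The lengths of the two lists encode the stopping times; conversely, the symbols before a
stopping time determine it. -/
theorem key_eq_iff (hr : 0 < r) {ω τ : ℕ → Digit m} :
    S.key r τ = S.key r ω ↔
      (∀ k < S.stopA r ω, τ k = ω k) ∧ ∀ k < S.stopB r ω, rowProj τ k = rowProj ω k := by
  constructor
  · intro h
    rw [key, key, Prod.mk.injEq] at h
    have hA : S.stopA r τ = S.stopA r ω := by simpa using congrArg List.length h.1
    have hB : S.stopB r τ = S.stopB r ω := by simpa using congrArg List.length h.2
    rw [hA, hB, List.map_inj_left, List.map_inj_left] at h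
    simpa using h
  · rintro ⟨h1, h2⟩
    rw [key, key, Prod.mk.injEq, stopA_congr hr h1, stopB_congr hr h2, List.map_inj_left,
      List.map_inj_left]
    simpa using ⟨h1, h2⟩

theorem disjoint_Ico_d {i i' : Fin N} (h : i ≠ i') :
    Disjoint (Ico (S.d i) (S.d i + S.b i)) (Ico (S.d i') (S.d i' + S.b i')) := by
  wlog hlt : i < i' generalizing i i'
  · exact (this h.symm (lt_of_le_of_ne (not_lt.1 hlt) h.symm)).symm
  have h1 := S.d_gap i ⟨i + 1, by omega⟩ rfl
  have h2 := S.d_mono ⟨i + 1, by omega⟩ i' (by simpa [Fin.le_def] using hlt)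
  rw [Set.disjoint_left]
  rintro z ⟨_, hz⟩ ⟨hz', _⟩
  linarith

theorem disjoint_Ico_c {e e' : Digit m} (h : e ≠ e') (h1 : e.1 = e'.1) :
    Disjoint (Ico (S.c e) (S.c e + S.a e)) (Ico (S.c e') (S.c e' + S.a e')) := by
  obtain ⟨i, j⟩ := e
  obtain ⟨i', j'⟩ := e'
  obtain rfl : i = i' := h1
  have hj : j ≠ j' := fun hj => h (by rw [hj])
  clear h
  wlog hlt : j < j' generalizing j j'
  · exact (this j' j hj.symm (lt_of_le_of_ne (not_lt.1 hlt) hj.symm)).symm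
  have h1 := S.c_gap i j ⟨j + 1, by omega⟩ rfl
  have h2 := S.c_mono i ⟨j + 1, by omega⟩ j' (by simpa [Fin.le_def] using hlt)
  rw [Set.disjoint_left]
  rintro z ⟨_, hz⟩ ⟨hz', _⟩
  linarith

/-- Different row words give disjoint vertical sides. If the row words agree, the digit words
differ, and at each disagreement the two digits lie in one row because `stopA` ≤ `stopB`, so
horizontal separation within a row applies. -/
theorem disjoint_rect (hr : 0 < r) {ω τ : ℕ → Digit m} (h : S.key r τ ≠ S.key r ω) :
    Disjoint (S.rect r ω) (S.rect r τ) := by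
  obtain ⟨q, -, hq1, hq⟩ := S.exists_ratio
  rw [rect, rect, Set.disjoint_prod]
  by_cases hB : ∀ k < S.stopB r ω, rowProj τ k = rowProj ω k
  · left
    have hA : ∃ k < S.stopA r ω, ω k ≠ τ k := by
      by_contra! hA
      exact h ((key_eq_iff hr).2 ⟨fun k hk => (hA k hk).symm, hB⟩)
    exact disjoint_Ico_stop (fun k => S.a_pos _) (fun k => S.a_pos _) (fun e => (S.c_mem e).1)
      S.c_top (fun k => (S.a_le_b _).trans (hq _)) hq1 hr hA fun k hk hne =>
        disjoint_Ico_c hne (hB k (hk.trans_le (stopA_le_stopB hr ω))).symm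
  · right
    push Not at hB
    obtain ⟨k, hk, hne⟩ := hB
    exact disjoint_Ico_stop (fun k => S.b_pos _) (fun k => S.b_pos _) (fun e => (S.d_mem e).1)
      S.d_top (fun k => hq _) hq1 hr ⟨k, hk, hne.symm⟩ fun k hk hne => disjoint_Ico_d hne

/-! ### Coordinates, measurability and size of approximate squares. -/

theorem wordMap_apply (ω : ℕ → Digit m) (n : ℕ) (x : Plane) :
    S.wordMap ω n x 0 = off (S.ratioA ω) (S.c ∘ ω) n + len (S.ratioA ω) n * x 0 ∧
      S.wordMap ω n x 1 =
        off (S.ratioB ω) (S.d ∘ rowProj ω) n + len (S.ratioB ω) n * x 1 := by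
  induction n generalizing x with
  | zero => simp [wordMap, off, len]
  | succ n ih =>
    rw [wordMap, Function.comp_apply, (ih _).1, (ih _).2, off_succ, off_succ, len_succ, len_succ]
    simp only [map, ratioA, ratioB, rowProj, Function.comp_apply]
    constructor <;> simp <;> ring

/-- The intervals are closed here: the coded point may lie on an upper or right side, outside the
half-open `rect`. -/
theorem proj_mem_Icc (ω : ℕ → Digit m) (n : ℕ) :
    S.proj ω 0 ∈ Icc (off (S.ratioA ω) (S.c ∘ ω) n)
        (off (S.ratioA ω) (S.c ∘ ω) n + len (S.ratioA ω) n) ∧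
      S.proj ω 1 ∈ Icc (off (S.ratioB ω) (S.d ∘ rowProj ω) n)
        (off (S.ratioB ω) (S.d ∘ rowProj ω) n + len (S.ratioB ω) n) := by
  have h : S.proj ω ∈ ⋂ n, S.wordMap ω n '' unitSquare := by
    rw [S.iInter_wordMap_unitSquare]
    rfl
  obtain ⟨x, hx, hxω⟩ := mem_iInter.1 h n
  rw [← hxω, (wordMap_apply ω n x).1, (wordMap_apply ω n x).2]
  have hA := len_pos (ratioA_pos (S := S) ω) n
  have hB := len_pos (ratioB_pos (S := S) ω) n
  have h0 := hx 0
  have h1 := hx 1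
  rw [mem_Icc] at h0 h1 ⊢
  rw [mem_Icc]
  refine ⟨⟨?_, ?_⟩, ?_, ?_⟩ <;> nlinarith

theorem tendsto_wordMap (ω : ℕ → Digit m) :
    Tendsto (fun n => S.wordMap ω n 0) atTop (𝓝 (S.proj ω)) := by
  obtain ⟨r, hr0, hr1, hr⟩ := S.exists_ratio
  obtain ⟨C, hC⟩ := isCompact_unitSquare.isBounded.exists_norm_le
  refine CauchySeq.tendsto_limUnder (cauchySeq_of_le_geometric r C hr1 fun n => ?_)
  refine (S.dist_wordMap_le hr0 hr ω n 0 _).trans ?_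
  rw [dist_zero_left, mul_comm]
  gcongr
  exact hC _ (S.map_mem_unitSquare _ zero_mem_unitSquare)

theorem measurable_proj : Measurable S.proj := by
  refine measurable_of_tendsto_metrizable (f := fun n ω => S.wordMap ω n 0) (fun n => ?_)
    (tendsto_pi_nhds.2 tendsto_wordMap)
  have hm : ∀ (f : Digit m → ℝ) (k : ℕ), Measurable fun ω : ℕ → Digit m => f (ω k) :=
    fun f k => (measurable_of_finite f).comp (measurable_pi_apply k)
  have h : (fun ω => S.wordMap ω n 0) = fun ω : ℕ → Digit m => WithLp.toLp 2 ![
      ∑ k ∈ Finset.range n, (∏ l ∈ Finset.range k, S.a (ω l)) * S.c (ω k),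
      ∑ k ∈ Finset.range n, (∏ l ∈ Finset.range k, S.b (ω l).1) * S.d (ω k).1] := by
    ext ω i
    fin_cases i
    · simpa [off, len, ratioA] using (wordMap_apply (S := S) ω n 0).1
    · simpa [off, len, ratioB, rowProj] using (wordMap_apply (S := S) ω n 0).2
  rw [h]
  refine (WithLp.measurable_toLp 2 _).comp (measurable_pi_lambda _ fun i => ?_)
  fin_cases i
  · exact Finset.measurable_fun_sum (Finset.range n) fun k _ =>
      (Finset.measurable_fun_prod (Finset.range k) fun l _ => hm S.a l).mul (hm S.c k)
  · exact Finset.measurable_fun_sum (Finset.range n) fun k _ =>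
      (Finset.measurable_fun_prod (Finset.range k) fun l _ => hm (fun e => S.b e.1) l).mul
        (hm (fun e => S.d e.1) k)

theorem len_stopA_le (hr : 0 < r) (ω : ℕ → Digit m) : len (S.ratioA ω) (S.stopA r ω) ≤ r := by
  obtain ⟨q, -, hq1, hq⟩ := S.exists_ratio
  exact len_stop_le (ratioA_pos ω) (fun k => (S.a_le_b _).trans (hq _)) hq1 hr

theorem len_stopB_le (hr : 0 < r) (ω : ℕ → Digit m) : len (S.ratioB ω) (S.stopB r ω) ≤ r := by
  obtain ⟨q, -, hq1, hq⟩ := S.exists_ratio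
  exact len_stop_le (ratioB_pos ω) (fun k => hq _) hq1 hr

/-- Points with the same code at scale `r` are at distance at most `2 r`. -/
theorem dist_proj_le_of_key_eq (hr : 0 < r) {ω τ : ℕ → Digit m} (h : S.key r τ = S.key r ω) :
    dist (S.proj τ) (S.proj ω) ≤ 2 * r := by
  obtain ⟨h1, h2⟩ := (key_eq_iff hr).1 h
  have a1 : ∀ k < S.stopA r ω, S.ratioA τ k = S.ratioA ω k := fun k hk => by
    simp [ratioA, h1 k hk]
  have b1 : ∀ k < S.stopB r ω, S.ratioB τ k = S.ratioB ω k := fun k hk => by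
    simp [ratioB, h2 k hk]
  have hτ := (proj_mem_Icc (S := S) τ (S.stopA r ω)).1
  have hω := (proj_mem_Icc (S := S) ω (S.stopA r ω)).1
  have hτ' := (proj_mem_Icc (S := S) τ (S.stopB r ω)).2
  have hω' := (proj_mem_Icc (S := S) ω (S.stopB r ω)).2
  rw [len_congr a1, off_congr (d := S.c ∘ ω) a1 fun k hk => by simp [h1 k hk]] at hτ
  rw [len_congr b1, off_congr (d := S.d ∘ rowProj ω) b1 fun k hk => by simp [h2 k hk]] at hτ'
  have hA := len_stopA_le (S := S) hr ω
  have hB := len_stopB_le (S := S) hr ω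
  have k0 : |S.proj τ 0 - S.proj ω 0| ≤ r :=
    abs_le.2 ⟨by linarith [hτ.1, hτ.2, hω.1, hω.2], by linarith [hτ.1, hτ.2, hω.1, hω.2]⟩
  have k1 : |S.proj τ 1 - S.proj ω 1| ≤ r :=
    abs_le.2 ⟨by linarith [hτ'.1, hτ'.2, hω'.1, hω'.2], by linarith [hτ'.1, hτ'.2, hω'.1, hω'.2]⟩
  rw [EuclideanSpace.dist_eq, Fin.sum_univ_two, Real.dist_eq, Real.dist_eq]
  refine Real.sqrt_le_iff.2 ⟨by linarith, ?_⟩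
  have := pow_le_pow_left₀ (abs_nonneg _) k0 2
  have := pow_le_pow_left₀ (abs_nonneg _) k1 2
  nlinarith

theorem exists_pos_le_a (S : LGSystem m) : ∃ c : ℝ, 0 < c ∧ ∀ e, c ≤ S.a e := by
  rcases isEmpty_or_nonempty (Digit m) with h | h
  · exact ⟨1, one_pos, fun e => h.elim e⟩
  · obtain ⟨e, he⟩ := Finite.exists_min S.a
    exact ⟨S.a e, S.a_pos e, he⟩

/-- A set of diameter at most `r` meets a bounded number of approximate squares of size `r`. -/
theorem exists_card_key_le (S : LGSystem m) : ∃ M : ℕ, ∀ r : ℝ, 0 < r → r < 1 →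
    ∀ T : Set (ℕ → Digit m), (∀ ω ∈ T, ∀ τ ∈ T, dist (S.proj ω) (S.proj τ) ≤ r) →
      ∀ F : Finset (List (Digit m) × List (Fin N)), (F : Set _) ⊆ S.key r '' T → F.card ≤ M := by
  obtain ⟨c, hc0, hc⟩ := S.exists_pos_le_a
  -- Disjoint rectangles of area at least (c r)² inside a square of side 4r.
  refine ⟨⌈16 / c ^ 2⌉₊, fun r hr hr1 T hT F hF => ?_⟩
  rcases F.eq_empty_or_nonempty with rfl | ⟨κ₀, hκ₀⟩
  · simp
  have hex : ∀ κ ∈ F, ∃ ω ∈ T, S.key r ω = κ := fun κ hκ => hF hκ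
  have : Nonempty (ℕ → Digit m) := (hex κ₀ hκ₀).nonempty
  choose! g hgT hg using hex
  set x := S.proj (g κ₀) with hx
  -- Each rectangle has sides at most r, and its closure contains a point within r of `x`.
  have hsub : (⋃ κ ∈ F, S.rect r (g κ)) ⊆
      Icc (x 0 - 2 * r) (x 0 + 2 * r) ×ˢ Icc (x 1 - 2 * r) (x 1 + 2 * r) := by
    refine iUnion₂_subset fun κ hκ => ?_
    have hd := hT _ (hgT κ hκ) _ (hgT κ₀ hκ₀)
    rw [← hx, dist_eq_norm] at hd
    have hn := fun i => (PiLp.norm_apply_le (S.proj (g κ) - x) i).trans hd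
    have h0 := abs_le.1 (hn 0)
    have h1 := abs_le.1 (hn 1)
    simp only [PiLp.sub_apply] at h0 h1
    have hA := len_stopA_le (S := S) hr (g κ)
    have hB := len_stopB_le (S := S) hr (g κ)
    have p0 := (proj_mem_Icc (S := S) (g κ) (S.stopA r (g κ))).1
    have p1 := (proj_mem_Icc (S := S) (g κ) (S.stopB r (g κ))).2
    rw [mem_Icc] at p0 p1
    refine prod_mono ?_ ?_
    · exact Ico_subset_Icc_self.trans (Icc_subset_Icc (by linarith) (by linarith))
    · exact Ico_subset_Icc_self.trans (Icc_subset_Icc (by linarith) (by linarith))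
  have hvol : ∀ κ ∈ F, ENNReal.ofReal ((c * r) * (c * r)) ≤ volume (S.rect r (g κ)) := by
    intro κ _
    rw [rect, Measure.volume_eq_prod, Measure.prod_prod, Real.volume_Ico, Real.volume_Ico,
      ENNReal.ofReal_mul (by positivity), add_sub_cancel_left, add_sub_cancel_left]
    gcongr
    · exact (mul_lt_len_stop (ratioA_pos _) ((S.a_le_b _).trans_lt (S.b_lt_one _))
        (fun k => hc _) hc0 hr1).le
    · exact (mul_lt_len_stop (ratioB_pos _) (S.b_lt_one _)
        (fun k => (hc _).trans (S.a_le_b _)) hc0 hr1).le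
  have hsum : (F.card : ℝ≥0∞) * ENNReal.ofReal ((c * r) * (c * r)) ≤
      ENNReal.ofReal ((4 * r) * (4 * r)) := by
    calc (F.card : ℝ≥0∞) * ENNReal.ofReal ((c * r) * (c * r))
        = ∑ κ ∈ F, ENNReal.ofReal ((c * r) * (c * r)) := by simp
      _ ≤ ∑ κ ∈ F, volume (S.rect r (g κ)) := Finset.sum_le_sum hvol
      _ = volume (⋃ κ ∈ F, S.rect r (g κ)) := by
          refine (measure_biUnion_finset (fun κ hκ κ' hκ' hne => ?_) fun κ _ => ?_).symm
          · refine disjoint_rect hr ?_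
            rw [hg κ hκ, hg κ' hκ']
            exact hne.symm
          · exact measurableSet_Ico.prod measurableSet_Ico
      _ ≤ _ := measure_mono hsub
      _ = _ := by
          rw [Measure.volume_eq_prod, Measure.prod_prod, Real.volume_Icc, Real.volume_Icc,
            ← ENNReal.ofReal_mul (by linarith)]
          congr 1
          ring
  rw [← ENNReal.ofReal_natCast, ← ENNReal.ofReal_mul (by positivity),
    ENNReal.ofReal_le_ofReal_iff (by positivity)] at hsum
  have h3 : (F.card : ℝ) ≤ 16 / c ^ 2 := by
    rw [le_div_iff₀ (by positivity)]
    have hr2 : 0 < r * r := mul_pos hr hr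
    refine le_of_mul_le_mul_right ?_ hr2
    linarith
  exact_mod_cast h3.trans (Nat.le_ceil _)

end LGSystem

/-! ### Asymptotics of stopping times -/

section Stop

variable {x : ℕ → ℝ}

theorem len_antitone (hx : ∀ k, 0 < x k) (hx1 : ∀ k, x k ≤ 1) : Antitone (len x) :=
  antitone_nat_of_succ_le fun n => by
    rw [len_succ]
    exact mul_le_of_le_one_right (len_pos hx n).le (hx1 n)

theorem tendsto_stop_atTop {q : ℝ} (hx : ∀ k, 0 < x k) (hq : ∀ k, x k ≤ q) (hq1 : q < 1) :
    Tendsto (stopTime x) (𝓝[>] 0) atTop := by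
  refine tendsto_atTop.2 fun K => ?_
  filter_upwards [Ioo_mem_nhdsGT (len_pos hx K)] with r hr
  by_contra! h
  have h1 := len_stop_le hx hq hq1 hr.1
  have h2 := len_antitone hx (fun k => (hq k).trans hq1.le) h.le
  linarith [hr.2]

/-- The length at the stopping time is r up to a factor in [c, 1], so log r is the sum of the log
ratios up to a bounded error, which disappears after division by the stopping time. -/
theorem tendsto_stop_div_log {q c lam : ℝ} (hx : ∀ k, 0 < x k) (hq : ∀ k, x k ≤ q) (hq1 : q < 1)
    (hc0 : 0 < c) (hc : ∀ k, c ≤ x k) (hlam : lam ≠ 0)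
    (h : Tendsto (fun n : ℕ => (∑ k ∈ Finset.range n, Real.log (x k)) / n) atTop (𝓝 (-lam))) :
    Tendsto (fun r => (stopTime x r : ℝ) / Real.log r) (𝓝[>] 0) (𝓝 (-(1 / lam))) := by
  have hs := tendsto_stop_atTop hx hq hq1
  have hbdd : ∀ᶠ r in 𝓝[>] (0 : ℝ),
      |Real.log r - Real.log (len x (stopTime x r))| ≤ -Real.log c := by
    filter_upwards [Ioo_mem_nhdsGT one_pos] with r hr
    have h0 := len_pos hx (stopTime x r)
    have h1 := Real.log_le_log h0 (len_stop_le hx hq hq1 hr.1)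
    have h2 := Real.log_le_log (mul_pos hc0 hr.1)
      (mul_lt_len_stop hx ((hq 0).trans_lt hq1) hc hc0 hr.2).le
    rw [Real.log_mul hc0.ne' hr.1.ne'] at h2
    have h3 := Real.log_nonpos hc0.le ((hc 0).trans ((hq 0).trans hq1.le))
    exact abs_le.2 ⟨by linarith, by linarith⟩
  have herr : Tendsto (fun r => (Real.log r - Real.log (len x (stopTime x r))) / (stopTime x r : ℝ))
      (𝓝[>] 0) (𝓝 0) := by
    refine squeeze_zero_norm' (a := fun r => -Real.log c / (stopTime x r : ℝ)) ?_
      ((tendsto_const_div_atTop_nhds_zero_nat _).comp hs)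
    filter_upwards [hbdd] with r hr
    rw [norm_div, Real.norm_natCast, Real.norm_eq_abs]
    gcongr
  have hlim : Tendsto (fun r => Real.log r / (stopTime x r : ℝ)) (𝓝[>] 0) (𝓝 (-lam)) := by
    have h2 := (h.comp hs).add herr
    rw [add_zero] at h2
    refine h2.congr fun r => ?_
    rw [Function.comp_apply, ← log_len hx, ← add_div]
    ring_nf
  have := hlim.inv₀ (neg_ne_zero.2 hlam)
  rw [show -(1 / lam) = (-lam)⁻¹ by rw [one_div, inv_neg]]
  exact this.congr fun r => inv_div _ _

end Stop

variable {N : ℕ} {m : Fin N → ℕ}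

/-! ### Digit frequencies -/

theorem HasFrequencies.tendsto_average {ω : ℕ → Digit m} {p : Digit m → ℝ}
    (h : HasFrequencies ω p) (f : Digit m → ℝ) :
    Tendsto (fun n : ℕ => (∑ k ∈ Finset.range n, f (ω k)) / n) atTop (𝓝 (∑ e, p e * f e)) := by
  have h1 : Tendsto (fun n : ℕ => ∑ e, (digitCount e ω n : ℝ) / n * f e) atTop
      (𝓝 (∑ e, p e * f e)) := tendsto_finsetSum _ fun e _ => (h e).mul_const _
  refine h1.congr fun n => ?_
  rw [← Finset.sum_fiberwise (s := Finset.range n) (g := ω), Finset.sum_div]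
  refine Finset.sum_congr rfl fun e _ => ?_
  rw [Finset.sum_congr rfl fun k hk => by rw [(Finset.mem_filter.1 hk).2], Finset.sum_const,
    nsmul_eq_mul, digitCount]
  ring

/-! ### Bernoulli measures -/

/-- The total weight of a row. -/
def rowSum (p : Digit m → ℝ) (i : Fin N) : ℝ := ∑ j, p ⟨i, j⟩

theorem rowSum_nonneg {p : Digit m → ℝ} (hp : ∀ e, 0 ≤ p e) (i : Fin N) : 0 ≤ rowSum p i :=
  Finset.sum_nonneg fun _ _ => hp _

theorem sum_mul_fst (p : Digit m → ℝ) (f : Fin N → ℝ) :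
    ∑ e, p e * f e.1 = ∑ i, rowSum p i * f i := by
  simp only [Fintype.sum_sigma, rowSum, Finset.sum_mul]

theorem digitLaw_singleton (p : Digit m → ℝ) (e : Digit m) :
    digitLaw p {e} = ENNReal.ofReal (p e) := by
  classical
  simp [digitLaw, Measure.finsetSum_apply, Set.indicator_apply]

theorem digitLaw_fst_preimage {p : Digit m → ℝ} (hp : ∀ e, 0 ≤ p e) (i : Fin N) :
    digitLaw p (Sigma.fst ⁻¹' {i}) = ENNReal.ofReal (rowSum p i) := by
  classical
  rw [rowSum, ENNReal.ofReal_sum_of_nonneg fun j _ => hp _]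
  simp only [digitLaw, Measure.finsetSum_apply, Measure.smul_apply, smul_eq_mul,
    Measure.dirac_apply' _ MeasurableSet.of_discrete, Fintype.sum_sigma]
  rw [Finset.sum_eq_single i]
  · simp
  · intro i' _ hi'
    simp [hi']
  · simp

attribute [local instance] isProbabilityMeasure_digitLaw

theorem integral_digitLaw (p : stdSimplex ℝ (Digit m)) (f : Digit m → ℝ) :
    ∫ e, f e ∂digitLaw p.1 = ∑ e, p.1 e * f e := by
  rw [integral_fintype (.of_finite)]
  refine Finset.sum_congr rfl fun e _ => ?_
  rw [measureReal_def, digitLaw_singleton, ENNReal.toReal_ofReal (p.2.1 e), smul_eq_mul]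

theorem integral_bernoulli (p : stdSimplex ℝ (Digit m)) (f : Digit m → ℝ) (n : ℕ) :
    ∫ ω, f (ω n) ∂bernoulli p = ∑ e, p.1 e * f e := by
  rw [← integral_digitLaw, ← Measure.infinitePi_map_eval (fun _ : ℕ => digitLaw p.1) n,
    integral_map (measurable_pi_apply n).aemeasurable
      (measurable_of_finite f).aestronglyMeasurable]
  rfl

instance isProbabilityMeasure_bernoulli (p : stdSimplex ℝ (Digit m)) :
    IsProbabilityMeasure (bernoulli p) := by
  unfold bernoulli
  infer_instance

/-- The strong law of large numbers for the indicator of each digit. -/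
theorem ae_hasFrequencies (p : stdSimplex ℝ (Digit m)) :
    ∀ᵐ ω ∂bernoulli p, HasFrequencies ω p.1 := by
  classical
  refine ae_all_iff.2 fun e => ?_
  let g : Digit m → ℝ := fun e' => if e' = e then 1 else 0
  have hg : Measurable g := measurable_of_finite g
  have hm : ∀ n, Measurable fun ω : ℕ → Digit m => g (ω n) :=
    fun n => hg.comp (measurable_pi_apply n)
  have hind : ProbabilityTheory.iIndepFun (fun n (ω : ℕ → Digit m) => g (ω n)) (bernoulli p) :=
    ProbabilityTheory.iIndepFun_infinitePi (P := fun _ : ℕ => digitLaw p.1) (X := fun _ => g)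
      fun _ => hg
  have hmap : ∀ n, (bernoulli p).map (fun ω => g (ω n)) = (digitLaw p.1).map g := fun n => by
    rw [← Measure.infinitePi_map_eval (fun _ : ℕ => digitLaw p.1) n,
      Measure.map_map hg (measurable_pi_apply n)]
    rfl
  have h := ProbabilityTheory.strong_law_ae_real (μ := bernoulli p)
    (fun n (ω : ℕ → Digit m) => g (ω n))
    (Integrable.of_bound (hm 0).aestronglyMeasurable 1
      (ae_of_all _ fun ω => by simp only [g]; split_ifs <;> simp))
    (fun i j hij => hind.indepFun hij)
    (fun n => ⟨(hm n).aemeasurable, (hm 0).aemeasurable, by rw [hmap, hmap]⟩)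
  filter_upwards [h] with ω hω
  have h2 := integral_bernoulli p g 0
  rw [h2] at hω
  simpa [g, digitCount, Finset.sum_boole] using hω

/-- Since zero weights are allowed, this is what makes the logarithms of masses meaningful when w =
p. -/
theorem ae_forall_pos (p : stdSimplex ℝ (Digit m)) :
    ∀ᵐ ω ∂bernoulli p, ∀ k, 0 < p.1 (ω k) := by
  refine ae_all_iff.2 fun k => ?_
  have h : ∀ᵐ e ∂digitLaw p.1, 0 < p.1 e := by
    rw [ae_iff_of_countable]
    intro e he
    rw [digitLaw_singleton] at he
    exact ENNReal.ofReal_pos.1 (pos_iff_ne_zero.2 he)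
  rw [← Measure.infinitePi_map_eval (fun _ : ℕ => digitLaw p.1) k] at h
  exact ae_of_ae_map (measurable_pi_apply k).aemeasurable h

namespace LGSystem

variable {S : LGSystem m} {r : ℝ}

/-! ### Bernoulli mass of an approximate square. -/

theorem key_preimage_eq_pi (hr : 0 < r) (ω : ℕ → Digit m) :
    S.key r ⁻¹' {S.key r ω} = Set.pi (Finset.range (S.stopB r ω))
      fun k => if k < S.stopA r ω then {ω k} else Sigma.fst ⁻¹' {(ω k).1} := by
  ext τ
  rw [mem_preimage, mem_singleton_iff, key_eq_iff hr]
  simp only [Finset.coe_range, Set.mem_pi, mem_Iio]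
  constructor
  · rintro ⟨h1, h2⟩ k hk
    split_ifs with h
    · exact h1 k h
    · exact h2 k hk
  · intro h
    refine ⟨fun k hk => ?_, fun k hk => ?_⟩
    · simpa [hk] using h k (hk.trans_le (stopA_le_stopB hr ω))
    · have := h k hk
      split_ifs at this with h'
      · exact congrArg Sigma.fst this
      · exact this

theorem measurableSet_key_preimage (hr : 0 < r) (ω : ℕ → Digit m) :
    MeasurableSet (S.key r ⁻¹' {S.key r ω}) := by
  rw [key_preimage_eq_pi hr]
  exact MeasurableSet.pi (Finset.countable_toSet _) fun _ _ => MeasurableSet.of_discrete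

theorem bernoulli_key_preimage (w : stdSimplex ℝ (Digit m)) (hr : 0 < r) (ω : ℕ → Digit m) :
    (bernoulli w).real (S.key r ⁻¹' {S.key r ω}) =
      (∏ k ∈ Finset.range (S.stopA r ω), w.1 (ω k)) *
        ∏ k ∈ Finset.Ico (S.stopA r ω) (S.stopB r ω), rowSum w.1 (ω k).1 := by
  have hle := stopA_le_stopB (S := S) hr ω
  rw [measureReal_def, key_preimage_eq_pi hr, bernoulli,
    Measure.infinitePi_pi _ fun _ _ => MeasurableSet.of_discrete, ENNReal.toReal_prod,
    ← Finset.prod_range_mul_prod_Ico _ hle]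
  congr 1
  · refine Finset.prod_congr rfl fun k hk => ?_
    rw [if_pos (Finset.mem_range.1 hk), digitLaw_singleton, ENNReal.toReal_ofReal (w.2.1 _)]
  · refine Finset.prod_congr rfl fun k hk => ?_
    rw [if_neg (Finset.mem_Ico.1 hk).1.not_gt, digitLaw_fst_preimage w.2.1,
      ENNReal.toReal_ofReal (rowSum_nonneg w.2.1 _)]

theorem rowSum_pos {w : stdSimplex ℝ (Digit m)} {e : Digit m} (h : 0 < w.1 e) :
    0 < rowSum w.1 e.1 :=
  h.trans_le (Finset.single_le_sum (f := fun j => w.1 ⟨e.1, j⟩) (fun _ _ => w.2.1 _)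
    (Finset.mem_univ e.2))

theorem bernoulli_key_preimage_pos {w : stdSimplex ℝ (Digit m)} {ω : ℕ → Digit m}
    (hω : ∀ k, 0 < w.1 (ω k)) (hr : 0 < r) :
    0 < (bernoulli w).real (S.key r ⁻¹' {S.key r ω}) := by
  rw [bernoulli_key_preimage w hr]
  exact mul_pos (Finset.prod_pos fun k _ => hω k) (Finset.prod_pos fun k _ => rowSum_pos (hω k))

theorem log_bernoulli_key_preimage {w : stdSimplex ℝ (Digit m)} {ω : ℕ → Digit m}
    (hω : ∀ k, 0 < w.1 (ω k)) (hr : 0 < r) :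
    Real.log ((bernoulli w).real (S.key r ⁻¹' {S.key r ω})) =
      ∑ k ∈ Finset.range (S.stopA r ω), Real.log (w.1 (ω k)) +
        (∑ k ∈ Finset.range (S.stopB r ω), Real.log (rowSum w.1 (ω k).1) -
          ∑ k ∈ Finset.range (S.stopA r ω), Real.log (rowSum w.1 (ω k).1)) := by
  rw [bernoulli_key_preimage w hr, Real.log_mul, Real.log_prod, Real.log_prod,
    Finset.sum_Ico_eq_sub _ (stopA_le_stopB hr ω)]
  · exact fun k _ => (rowSum_pos (hω k)).ne'
  · exact fun k _ => (hω k).ne'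
  · exact (Finset.prod_pos fun k _ => hω k).ne'
  · exact (Finset.prod_pos fun k _ => rowSum_pos (hω k)).ne'

/-! ### Local dimensions -/

variable (S)

/-- Horizontal Lyapunov exponent of the weights `p`. -/
noncomputable def expA (p : Digit m → ℝ) : ℝ := -∑ e, p e * Real.log (S.a e)

/-- Vertical Lyapunov exponent of the weights `p`. -/
noncomputable def expB (p : Digit m → ℝ) : ℝ := -∑ e, p e * Real.log (S.b e.1)

/-- The local dimension, along approximate squares, of the Bernoulli measure with weights `w` at
points with digit frequencies `p`. -/
noncomputable def crossDim (p w : Digit m → ℝ) : ℝ :=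
  (-∑ e, p e * Real.log (w e)) / S.expA p +
    (1 / S.expB p - 1 / S.expA p) * (-∑ e, p e * Real.log (rowSum w e.1))

variable {S}

theorem expB_pos (p : stdSimplex ℝ (Digit m)) : 0 < S.expB p.1 := by
  have hlog : ∀ e : Digit m, Real.log (S.b e.1) < 0 := fun e =>
    Real.log_neg (S.b_pos e) (S.b_lt_one e)
  obtain ⟨e, he⟩ : ∃ e, 0 < p.1 e := by
    by_contra! h
    have := Finset.sum_nonpos fun e (_ : e ∈ Finset.univ) => h e
    linarith [p.2.2]
  rw [expB, ← Finset.sum_neg_distrib]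
  refine Finset.sum_pos' (fun e _ => ?_) ⟨e, Finset.mem_univ e, ?_⟩
  · have := mul_nonpos_of_nonneg_of_nonpos (p.2.1 e) (hlog e).le
    linarith
  · have := mul_neg_of_pos_of_neg he (hlog e)
    linarith

theorem expB_le_expA (p : stdSimplex ℝ (Digit m)) : S.expB p.1 ≤ S.expA p.1 := by
  refine neg_le_neg (Finset.sum_le_sum fun e _ => ?_)
  exact mul_le_mul_of_nonneg_left (Real.log_le_log (S.a_pos e) (S.a_le_b e)) (p.2.1 e)

theorem expA_pos (p : stdSimplex ℝ (Digit m)) : 0 < S.expA p.1 :=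
  (expB_pos p).trans_le (expB_le_expA p)

theorem tendsto_stopA_atTop (ω : ℕ → Digit m) :
    Tendsto (fun r => S.stopA r ω) (𝓝[>] 0) atTop := by
  obtain ⟨q, -, hq1, hq⟩ := S.exists_ratio
  exact tendsto_stop_atTop (ratioA_pos ω) (fun k => (S.a_le_b _).trans (hq _)) hq1

theorem tendsto_stopB_atTop (ω : ℕ → Digit m) :
    Tendsto (fun r => S.stopB r ω) (𝓝[>] 0) atTop := by
  obtain ⟨q, -, hq1, hq⟩ := S.exists_ratio
  exact tendsto_stop_atTop (ratioB_pos ω) (fun k => hq _) hq1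

theorem tendsto_stopA_div_log {p : stdSimplex ℝ (Digit m)} {ω : ℕ → Digit m}
    (h : HasFrequencies ω p.1) :
    Tendsto (fun r => (S.stopA r ω : ℝ) / Real.log r) (𝓝[>] 0) (𝓝 (-(1 / S.expA p.1))) := by
  obtain ⟨q, -, hq1, hq⟩ := S.exists_ratio
  obtain ⟨c, hc0, hc⟩ := S.exists_pos_le_a
  refine tendsto_stop_div_log (ratioA_pos ω) (fun k => (S.a_le_b _).trans (hq _)) hq1 hc0
    (fun k => hc _) (expA_pos p).ne' ?_
  rw [expA, neg_neg]
  exact h.tendsto_average fun e => Real.log (S.a e)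

theorem tendsto_stopB_div_log {p : stdSimplex ℝ (Digit m)} {ω : ℕ → Digit m}
    (h : HasFrequencies ω p.1) :
    Tendsto (fun r => (S.stopB r ω : ℝ) / Real.log r) (𝓝[>] 0) (𝓝 (-(1 / S.expB p.1))) := by
  obtain ⟨q, -, hq1, hq⟩ := S.exists_ratio
  obtain ⟨c, hc0, hc⟩ := S.exists_pos_le_a
  refine tendsto_stop_div_log (ratioB_pos ω) (fun k => hq _) hq1 hc0
    (fun k => (hc _).trans (S.a_le_b _)) (expB_pos p).ne' ?_
  rw [expB, neg_neg]
  exact h.tendsto_average fun e => Real.log (S.b e.1)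

/-- The quotient is the average over `n r` digits times n(r) / log r. -/
theorem tendsto_sum_div_log {p : Digit m → ℝ} {ω : ℕ → Digit m} (h : HasFrequencies ω p)
    {n : ℝ → ℕ} {l : ℝ} (hn : Tendsto n (𝓝[>] 0) atTop)
    (hnl : Tendsto (fun r => (n r : ℝ) / Real.log r) (𝓝[>] 0) (𝓝 l)) (f : Digit m → ℝ) :
    Tendsto (fun r => (∑ k ∈ Finset.range (n r), f (ω k)) / Real.log r) (𝓝[>] 0)
      (𝓝 ((∑ e, p e * f e) * l)) := by
  refine (((h.tendsto_average f).comp hn).mul hnl).congr' ?_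
  filter_upwards [hn.eventually_gt_atTop 0] with r hr
  have : (n r : ℝ) ≠ 0 := by exact_mod_cast hr.ne'
  simp only [Function.comp_apply]
  field_simp

theorem tendsto_log_bernoulli_div_log {p w : stdSimplex ℝ (Digit m)} {ω : ℕ → Digit m}
    (h : HasFrequencies ω p.1) (hω : ∀ k, 0 < w.1 (ω k)) :
    Tendsto (fun r => Real.log ((bernoulli w).real (S.key r ⁻¹' {S.key r ω})) / Real.log r)
      (𝓝[>] 0) (𝓝 (S.crossDim p.1 w.1)) := by
  have hA := tendsto_sum_div_log h (tendsto_stopA_atTop ω) (tendsto_stopA_div_log (S := S) h)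
  have hB := tendsto_sum_div_log h (tendsto_stopB_atTop ω) (tendsto_stopB_div_log (S := S) h)
  have h1 := (hA fun e => Real.log (w.1 e)).add
    ((hB fun e => Real.log (rowSum w.1 e.1)).sub (hA fun e => Real.log (rowSum w.1 e.1)))
  have e1 : S.crossDim p.1 w.1 = (∑ e, p.1 e * Real.log (w.1 e)) * -(1 / S.expA p.1) +
      ((∑ e, p.1 e * Real.log (rowSum w.1 e.1)) * -(1 / S.expB p.1) -
        (∑ e, p.1 e * Real.log (rowSum w.1 e.1)) * -(1 / S.expA p.1)) := by
    rw [crossDim]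
    ring
  rw [e1]
  refine h1.congr' ?_
  filter_upwards [self_mem_nhdsWithin] with r hr
  rw [log_bernoulli_key_preimage hω hr, ← sub_div, ← add_div]

theorem eventually_bernoulli_le_rpow {p w : stdSimplex ℝ (Digit m)} {ω : ℕ → Digit m}
    (h : HasFrequencies ω p.1) (hω : ∀ k, 0 < w.1 (ω k)) {s : ℝ} (hs : s < S.crossDim p.1 w.1) :
    ∀ᶠ r in 𝓝[>] 0, (bernoulli w).real (S.key r ⁻¹' {S.key r ω}) ≤ r ^ s := by
  filter_upwards [(tendsto_log_bernoulli_div_log h hω).eventually_const_lt hs,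
    Ioo_mem_nhdsGT one_pos] with r h1 hr
  rw [lt_div_iff_of_neg (Real.log_neg hr.1 hr.2)] at h1
  rw [← Real.log_le_log_iff (bernoulli_key_preimage_pos hω hr.1) (Real.rpow_pos_of_pos hr.1 s),
    Real.log_rpow hr.1]
  exact h1.le

theorem eventually_rpow_le_bernoulli {p w : stdSimplex ℝ (Digit m)} {ω : ℕ → Digit m}
    (h : HasFrequencies ω p.1) (hω : ∀ k, 0 < w.1 (ω k)) {s : ℝ} (hs : S.crossDim p.1 w.1 < s) :
    ∀ᶠ r in 𝓝[>] 0, r ^ s ≤ (bernoulli w).real (S.key r ⁻¹' {S.key r ω}) := by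
  filter_upwards [(tendsto_log_bernoulli_div_log h hω).eventually_lt_const hs,
    Ioo_mem_nhdsGT one_pos] with r h1 hr
  rw [div_lt_iff_of_neg (Real.log_neg hr.1 hr.2)] at h1
  rw [← Real.log_le_log_iff (Real.rpow_pos_of_pos hr.1 s) (bernoulli_key_preimage_pos hω hr.1),
    Real.log_rpow hr.1]
  exact h1.le

end LGSystem

namespace LGSystem

variable {S : LGSystem m}

/-! ### Upper bound -/

open scoped NNReal in
-- The approximate squares of size r that meet `F` cover the image, and each satisfies diam^s ≤ 2^s
-- r^s ≤ 2^s · mass. Their masses sum to at most 1, so the s-dimensional Hausdorff measure is at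
-- most 2^s.
theorem dimH_image_le_of_rpow_le {w : stdSimplex ℝ (Digit m)} {s : ℝ≥0} {F : Set (ℕ → Digit m)}
    {ρ : ℝ} (hρ : 0 < ρ) (hF : ∀ ω ∈ F, ∀ r ∈ Ioo 0 ρ,
      r ^ (s : ℝ) ≤ (bernoulli w).real (S.key r ⁻¹' {S.key r ω})) :
    dimH (S.proj '' F) ≤ s := by
  refine dimH_le_of_hausdorffMeasure_ne_top
    (ne_top_of_le_ne_top (ENNReal.ofReal_ne_top (r := 2 ^ (s : ℝ))) ?_)
  have hdiam : ∀ r : ℝ, 0 < r → ∀ κ, Metric.ediam (S.proj '' (S.key r ⁻¹' {κ})) ≤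
      ENNReal.ofReal (2 * r) := by
    intro r hr κ
    refine Metric.ediam_le ?_
    rintro _ ⟨ω, hω, rfl⟩ _ ⟨τ, hτ, rfl⟩
    rw [edist_dist]
    exact ENNReal.ofReal_le_ofReal (dist_proj_le_of_key_eq hr (Eq.trans hω (Eq.symm hτ)))
  have hlim : Tendsto (fun r : ℝ => ENNReal.ofReal (2 * r)) (𝓝[>] 0) (𝓝 0) := by
    have h : Continuous fun r : ℝ => ENNReal.ofReal (2 * r) :=
      ENNReal.continuous_ofReal.comp (continuous_const_mul 2)
    simpa using (h.tendsto 0).mono_left nhdsWithin_le_nhds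
  have hmain := Measure.hausdorffMeasure_le_liminf_tsum (s : ℝ) (S.proj '' F) (l := 𝓝[>] (0 : ℝ))
    (ι := fun r => ↥(S.key r '' F)) (fun r => ENNReal.ofReal (2 * r)) hlim
    (fun r κ => S.proj '' (S.key r ⁻¹' {κ.1}))
    (by
      filter_upwards [self_mem_nhdsWithin] with r hr κ
      exact hdiam r hr _)
    (by
      refine Eventually.of_forall fun r => ?_
      rintro _ ⟨ω, hω, rfl⟩
      exact mem_iUnion.2 ⟨⟨S.key r ω, mem_image_of_mem _ hω⟩, mem_image_of_mem _ rfl⟩)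
  refine hmain.trans ?_
  rw [← liminf_const (f := 𝓝[>] (0 : ℝ)) (ENNReal.ofReal (2 ^ (s : ℝ)))]
  refine liminf_le_liminf ?_
  filter_upwards [Ioo_mem_nhdsGT hρ] with r hr
  have hbound : ∀ κ : ↥(S.key r '' F), Metric.ediam (S.proj '' (S.key r ⁻¹' {κ.1})) ^ (s : ℝ) ≤
      ENNReal.ofReal (2 ^ (s : ℝ)) * bernoulli w (S.key r ⁻¹' {κ.1}) := by
    rintro ⟨_, ω, hω, rfl⟩
    refine (ENNReal.rpow_le_rpow (hdiam r hr.1 _) s.2).trans ?_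
    rw [ENNReal.ofReal_rpow_of_nonneg (by linarith [hr.1]) s.2, Real.mul_rpow zero_le_two hr.1.le,
      ENNReal.ofReal_mul (by positivity)]
    exact mul_le_mul' le_rfl (ENNReal.ofReal_le_of_le_toReal (hF ω hω r hr))
  refine (ENNReal.tsum_le_tsum hbound).trans ?_
  rw [ENNReal.tsum_mul_left]
  refine mul_le_of_le_one_right' ?_
  refine (tsum_meas_le_meas_iUnion_of_disjoint _ ?_ ?_).trans prob_le_one
  · rintro ⟨_, ω, hω, rfl⟩
    exact measurableSet_key_preimage hr.1 ω
  · intro κ κ' h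
    exact Disjoint.preimage _ (by simpa using fun h' => h (Subtype.ext h'))

open scoped NNReal in
-- Positive weights make the local estimate valid at every coding with frequencies p. The scale
-- below which it holds depends on the coding, so the set is cut into countably many pieces with a
-- uniform scale.
theorem dimH_freqSet_le {p w : stdSimplex ℝ (Digit m)} (hw : ∀ e, 0 < w.1 e) {s : ℝ≥0}
    (hs : S.crossDim p.1 w.1 < s) : dimH (S.freqSet p.1) ≤ s := by
  set F : ℕ → Set (ℕ → Digit m) := fun M => {ω | ∀ r ∈ Ioo (0 : ℝ) (1 / (M + 1)),
    r ^ (s : ℝ) ≤ (bernoulli w).real (S.key r ⁻¹' {S.key r ω})}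
  have hsub : S.freqSet p.1 ⊆ ⋃ M, S.proj '' F M := by
    rintro _ ⟨ω, hω, rfl⟩
    obtain ⟨ρ, hρ, h⟩ := mem_nhdsGT_iff_exists_Ioo_subset.1
      (eventually_rpow_le_bernoulli hω (fun k => hw _) hs)
    obtain ⟨M, hM⟩ := exists_nat_one_div_lt (mem_Ioi.1 hρ)
    exact mem_iUnion.2 ⟨M, mem_image_of_mem _ fun r hr => h ⟨hr.1, hr.2.trans hM⟩⟩
  refine (dimH_mono hsub).trans ?_
  rw [dimH_iUnion]
  exact iSup_le fun M => dimH_image_le_of_rpow_le Nat.one_div_pos_of_nat fun ω hω => hω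

theorem crossDim_self_nonneg (p : stdSimplex ℝ (Digit m)) : 0 ≤ S.crossDim p.1 p.1 := by
  have hrow : ∀ i, 0 ≤ rowSum p.1 i := rowSum_nonneg p.2.1
  have hsum : ∑ i, rowSum p.1 i = 1 := by
    rw [← p.2.2, Fintype.sum_sigma]
    rfl
  have hA := expA_pos (S := S) p
  have hB := expB_pos (S := S) p
  have h1 : ∑ e, p.1 e * Real.log (p.1 e) ≤ 0 := Finset.sum_nonpos fun e _ =>
    Real.mul_log_nonpos (p.2.1 e)
      (p.2.2 ▸ Finset.single_le_sum (fun e _ => p.2.1 e) (Finset.mem_univ e))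
  have h2 : ∑ e, p.1 e * Real.log (rowSum p.1 e.1) ≤ 0 := by
    rw [sum_mul_fst p.1 fun i => Real.log (rowSum p.1 i)]
    exact Finset.sum_nonpos fun i _ => Real.mul_log_nonpos (hrow i)
      (hsum ▸ Finset.single_le_sum (fun i _ => hrow i) (Finset.mem_univ i))
  have h3 := one_div_le_one_div_of_le hB (expB_le_expA (S := S) p)
  refine add_nonneg (div_nonneg (by linarith) hA.le) (mul_nonneg (by linarith) (by linarith))

/-- Weights that dominate a multiple of `p` close to one increase the cross dimension by little. -/
theorem crossDim_le_of_mul_le {p w : stdSimplex ℝ (Digit m)} {t : ℝ} (ht : 0 < t)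
    (h : ∀ e, t * p.1 e ≤ w.1 e) :
    S.crossDim p.1 w.1 ≤ S.crossDim p.1 p.1 - Real.log t / S.expB p.1 := by
  have hA := expA_pos (S := S) p
  have hB := expB_pos (S := S) p
  have hrow : ∀ i, t * rowSum p.1 i ≤ rowSum w.1 i := fun i => by
    rw [rowSum, Finset.mul_sum]
    exact Finset.sum_le_sum fun j _ => h _
  -- Digits with p_e = 0 contribute nothing, so `f` need only be positive where p is.
  have key : ∀ f g : Digit m → ℝ, (∀ e, 0 < p.1 e → 0 < f e) → (∀ e, t * f e ≤ g e) →
      Real.log t + ∑ e, p.1 e * Real.log (f e) ≤ ∑ e, p.1 e * Real.log (g e) := by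
    intro f g hf hfg
    have h1 : Real.log t = ∑ e, p.1 e * Real.log t := by
      rw [← Finset.sum_mul, p.2.2, one_mul]
    rw [h1, ← Finset.sum_add_distrib]
    refine Finset.sum_le_sum fun e _ => ?_
    rcases (p.2.1 e).eq_or_lt with h0 | h0
    · simp [← h0]
    · rw [← mul_add, ← Real.log_mul ht.ne' (hf e h0).ne']
      exact mul_le_mul_of_nonneg_left
        (Real.log_le_log (mul_pos ht (hf e h0)) (hfg e)) h0.le
  have k1 := key p.1 w.1 (fun e he => he) h
  have k2 := key (fun e => rowSum p.1 e.1) (fun e => rowSum w.1 e.1) (fun e he => rowSum_pos he)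
    fun e => hrow e.1
  have h3 := sub_nonneg.2 (one_div_le_one_div_of_le hB (expB_le_expA (S := S) p))
  have k1' := mul_le_mul_of_nonneg_right k1 (one_div_nonneg.2 hA.le)
  have k2' := mul_le_mul_of_nonneg_left k2 h3
  have hcross : ∀ v : Digit m → ℝ, S.crossDim p.1 v =
      (-∑ e, p.1 e * Real.log (v e)) * (1 / S.expA p.1) +
        (1 / S.expB p.1 - 1 / S.expA p.1) * (-∑ e, p.1 e * Real.log (rowSum v e.1)) := fun v => by
    rw [crossDim, ← div_eq_mul_one_div]
  rw [hcross, hcross, div_eq_mul_one_div (Real.log t)]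
  -- The coefficients 1/λ and 1/λ^v - 1/λ of log t add up to 1/λ^v.
  linarith

/-- Mix p with the uniform weights in proportion t : 1 - t. -/
theorem exists_pos_weights (p : stdSimplex ℝ (Digit m)) {t : ℝ} (ht0 : 0 ≤ t) (ht1 : t < 1) :
    ∃ w : stdSimplex ℝ (Digit m), (∀ e, 0 < w.1 e) ∧ ∀ e, t * p.1 e ≤ w.1 e := by
  have hne : Nonempty (Digit m) := by
    by_contra h
    rw [not_nonempty_iff] at h
    simpa using p.2.2
  have hcard : (0 : ℝ) < Fintype.card (Digit m) := by exact_mod_cast Fintype.card_pos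
  have hu : 0 < (1 - t) / Fintype.card (Digit m) := div_pos (by linarith) hcard
  refine ⟨⟨fun e => t * p.1 e + (1 - t) / Fintype.card (Digit m), fun e => ?_, ?_⟩,
    fun e => ?_, fun e => ?_⟩
  · exact add_nonneg (mul_nonneg ht0 (p.2.1 e)) hu.le
  · rw [Finset.sum_add_distrib, ← Finset.mul_sum, p.2.2, Finset.sum_const, Finset.card_univ,
      nsmul_eq_mul]
    field_simp
    ring
  · exact add_pos_of_nonneg_of_pos (mul_nonneg ht0 (p.2.1 e)) hu
  · exact le_add_of_nonneg_right hu.le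

open scoped NNReal in
theorem dimH_freqSet_le_crossDim (p : stdSimplex ℝ (Digit m)) :
    dimH (S.freqSet p.1) ≤ ENNReal.ofReal (S.crossDim p.1 p.1) := by
  refine le_of_forall_gt_imp_ge_of_dense fun s hs => ?_
  induction s using ENNReal.recTopCoe with
  | top => exact le_top
  | coe s =>
    have hs' : S.crossDim p.1 p.1 < s := by
      rw [← ENNReal.ofReal_coe_nnreal, ENNReal.ofReal_lt_ofReal_iff_of_nonneg
        (crossDim_self_nonneg p)] at hs
      exact hs
    have hlim : Tendsto (fun t : ℝ => S.crossDim p.1 p.1 - Real.log t / S.expB p.1) (𝓝[<] 1)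
        (𝓝 (S.crossDim p.1 p.1)) := by
      have h : ContinuousAt (fun t : ℝ => S.crossDim p.1 p.1 - Real.log t / S.expB p.1) 1 :=
        continuousAt_const.sub ((Real.continuousAt_log one_ne_zero).div_const _)
      simpa [ContinuousAt] using h.tendsto.mono_left (nhdsWithin_le_nhds (s := Iio 1))
    obtain ⟨t, ht, ht0, ht1⟩ :=
      ((hlim.eventually_lt_const hs').and (Ioo_mem_nhdsLT one_pos)).exists
    obtain ⟨w, hw, hpw⟩ := exists_pos_weights p ht0.le ht1
    exact dimH_freqSet_le hw ((crossDim_le_of_mul_le ht0 hpw).trans_lt ht)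

/-! ### Lower bound -/

/-- The codings in `G` of points near `U` occupy at most `C` approximate squares of size r, each of
mass at most r^s. -/
theorem exists_map_proj_restrict_le (S : LGSystem m) (w : stdSimplex ℝ (Digit m)) :
    ∃ C : ℕ, ∀ (s : ℝ) (G : Set (ℕ → Digit m)) (r : ℝ), 0 < r → r < 1 →
      (∀ ω ∈ G, (bernoulli w).real (S.key r ⁻¹' {S.key r ω}) ≤ r ^ s) →
        ∀ U : Set Plane, Metric.ediam U ≤ ENNReal.ofReal r →
          ((bernoulli w).restrict G).map S.proj U ≤ C * ENNReal.ofReal (r ^ s) := by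
  obtain ⟨C, hC⟩ := S.exists_card_key_le
  refine ⟨C, fun s G r hr hr1 hG U hU => ?_⟩
  -- Passing to the closure makes the set measurable and keeps its diameter.
  set T := S.proj ⁻¹' closure U ∩ G
  have hdist : ∀ ω ∈ T, ∀ τ ∈ T, dist (S.proj ω) (S.proj τ) ≤ r := by
    intro ω hω τ hτ
    rw [← ENNReal.ofReal_le_ofReal_iff hr.le, ← edist_dist]
    refine (Metric.edist_le_ediam_of_mem (mem_preimage.1 hω.1) (mem_preimage.1 hτ.1)).trans ?_
    rwa [Metric.ediam_closure]
  have hcard := hC r hr hr1 T hdist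
  have hfin : (S.key r '' T).Finite := by
    by_contra h
    obtain ⟨F, hF, hF'⟩ := Set.Infinite.exists_subset_card_eq h (C + 1)
    have := hcard F hF
    omega
  have hcardT := hcard hfin.toFinset (by simp)
  calc ((bernoulli w).restrict G).map S.proj U
      ≤ ((bernoulli w).restrict G).map S.proj (closure U) := measure_mono subset_closure
    _ = bernoulli w T := by
        rw [Measure.map_apply measurable_proj isClosed_closure.measurableSet,
          Measure.restrict_apply (measurable_proj isClosed_closure.measurableSet)]
    _ ≤ bernoulli w (⋃ κ ∈ hfin.toFinset, S.key r ⁻¹' {κ}) := by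
        refine measure_mono fun ω hω => ?_
        simp only [mem_iUnion]
        exact ⟨S.key r ω, hfin.mem_toFinset.2 (mem_image_of_mem _ hω), rfl⟩
    _ ≤ ∑ κ ∈ hfin.toFinset, bernoulli w (S.key r ⁻¹' {κ}) := measure_biUnion_finset_le _ _
    _ ≤ ∑ κ ∈ hfin.toFinset, ENNReal.ofReal (r ^ s) := by
        refine Finset.sum_le_sum fun κ hκ => ?_
        obtain ⟨ω, hω, rfl⟩ := hfin.mem_toFinset.1 hκ
        rw [← ofReal_measureReal]
        exact ENNReal.ofReal_le_ofReal (hG ω hω.2)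
    _ = hfin.toFinset.card * ENNReal.ofReal (r ^ s) := by simp
    _ ≤ C * ENNReal.ofReal (r ^ s) := by gcongr

open scoped NNReal in
-- Almost every coding lies in some `G M`, where the mass bound is uniform below scale 1/(M+1). Some
-- `G M` therefore has positive mass, and its projected measure is dominated by a multiple of
-- Hausdorff measure.
theorem le_dimH_freqSet {p : stdSimplex ℝ (Digit m)} {s : ℝ≥0}
    (hs : s < S.crossDim p.1 p.1) : s ≤ dimH (S.freqSet p.1) := by
  obtain ⟨C, hC⟩ := exists_map_proj_restrict_le S p
  set G : ℕ → Set (ℕ → Digit m) := fun M => {ω | HasFrequencies ω p.1 ∧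
    ∀ r ∈ Ioo (0 : ℝ) (1 / (M + 1)), (bernoulli p).real (S.key r ⁻¹' {S.key r ω}) ≤ r ^ (s : ℝ)}
  obtain ⟨M, hM⟩ : ∃ M, bernoulli p (G M) ≠ 0 := by
    by_contra! h
    have h0 : bernoulli p (⋃ M, G M) = 0 := measure_iUnion_null h
    have h1 : ∀ᵐ ω ∂bernoulli p, ω ∈ ⋃ M, G M := by
      filter_upwards [ae_hasFrequencies p, ae_forall_pos p] with ω hω hpos
      obtain ⟨ρ, hρ, h⟩ := mem_nhdsGT_iff_exists_Ioo_subset.1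
        (eventually_bernoulli_le_rpow hω hpos hs)
      obtain ⟨M, hM⟩ := exists_nat_one_div_lt (mem_Ioi.1 hρ)
      exact mem_iUnion.2 ⟨M, hω, fun r hr => h ⟨hr.1, hr.2.trans hM⟩⟩
    obtain ⟨ω, h3, h4⟩ := (h1.and (measure_eq_zero_iff_ae_notMem.1 h0)).exists
    exact h4 h3
  set ν := ((bernoulli p).restrict (G M)).map S.proj
  have hρ : (0 : ℝ) < 1 / (M + 1) := Nat.one_div_pos_of_nat
  have hρ1 : (1 : ℝ) / (M + 1) ≤ 1 := by
    rw [div_le_one (by positivity)]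
    linarith [M.cast_nonneg (α := ℝ)]
  -- The added 1 keeps the constant invertible if `C` is 0. Halving the scale below leaves room for
  -- some r strictly between the diameter and 1/(M+1).
  have hle : ((C : ℝ≥0∞) + 1)⁻¹ • ν ≤ Measure.hausdorffMeasure (s : ℝ) := by
    refine Measure.le_hausdorffMeasure _ _ (ENNReal.ofReal (1 / (M + 1) / 2))
      (ENNReal.ofReal_pos.2 (by positivity)) fun U hU => ?_
    have hfin : Metric.ediam U ≠ ⊤ := ne_top_of_le_ne_top ENNReal.ofReal_ne_top hU
    obtain ⟨δ, hδ0, hδ⟩ : ∃ δ : ℝ, 0 ≤ δ ∧ Metric.ediam U = ENNReal.ofReal δ :=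
      ⟨_, ENNReal.toReal_nonneg, (ENNReal.ofReal_toReal hfin).symm⟩
    have hδρ : δ < 1 / (M + 1) := by
      rw [hδ, ENNReal.ofReal_le_ofReal_iff (by positivity)] at hU
      linarith
    -- The diameter δ may be 0, whereas the estimate needs a positive size; so it is applied for r >
    -- δ and r decreases to δ.
    have hlim : Tendsto (fun r : ℝ => (C : ℝ≥0∞) * ENNReal.ofReal (r ^ (s : ℝ))) (𝓝[>] δ)
        (𝓝 (C * ENNReal.ofReal (δ ^ (s : ℝ)))) := by
      refine ENNReal.Tendsto.const_mul ?_ (Or.inr (ENNReal.natCast_ne_top C))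
      exact (ENNReal.continuous_ofReal.comp
        (Real.continuous_rpow_const s.2)).continuousAt.tendsto.mono_left nhdsWithin_le_nhds
    have hνU : ν U ≤ C * ENNReal.ofReal (δ ^ (s : ℝ)) := by
      refine ge_of_tendsto hlim ?_
      filter_upwards [Ioo_mem_nhdsGT hδρ] with r hr
      have hr0 := hδ0.trans_lt hr.1
      exact hC s (G M) r hr0 (hr.2.trans_le hρ1) (fun ω hω => hω.2 r ⟨hr0, hr.2⟩) U
        (hδ ▸ ENNReal.ofReal_le_ofReal hr.1.le)
    rw [Measure.smul_apply, smul_eq_mul, hδ, ENNReal.ofReal_rpow_of_nonneg hδ0 s.coe_nonneg,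
      ENNReal.inv_mul_le_iff (by simp) (by simp)]
    exact hνU.trans (by gcongr; exact le_self_add)
  refine le_dimH_of_hausdorffMeasure_ne_zero fun h0 => hM ?_
  have h1 : ((C : ℝ≥0∞) + 1)⁻¹ * ν (S.freqSet p.1) = 0 :=
    le_antisymm ((hle _).trans h0.le) zero_le
  have h2 : ν (S.freqSet p.1) = 0 := by
    simpa using h1
  -- This inequality needs no measurability of `freqSet`.
  have h3 := Measure.le_map_apply (μ := (bernoulli p).restrict (G M))
    (measurable_proj (S := S)).aemeasurable (S.freqSet p.1)
  rw [← Measure.restrict_apply_self (bernoulli p) (G M)]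
  refine measure_mono_null (fun ω hω => ?_) (le_antisymm (h3.trans h2.le) zero_le)
  exact mem_image_of_mem _ hω.1

open scoped NNReal in
theorem dimH_freqSet (p : stdSimplex ℝ (Digit m)) :
    dimH (S.freqSet p.1) = ENNReal.ofReal (S.crossDim p.1 p.1) := by
  refine le_antisymm (dimH_freqSet_le_crossDim p) (le_of_forall_lt_imp_le_of_dense fun s hs => ?_)
  lift s to ℝ≥0 using hs.ne_top
  refine le_dimH_freqSet ?_
  rw [← ENNReal.ofReal_coe_nnreal] at hs
  exact (ENNReal.ofReal_lt_ofReal_iff_of_nonneg s.coe_nonneg).1 hs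

/-! ### The Ledrappier–Young dimension -/

theorem map_rowProj_bernoulli (p : stdSimplex ℝ (Digit m)) :
    (bernoulli p).map rowProj =
      Measure.infinitePi fun _ : ℕ => (digitLaw p.1).map Sigma.fst :=
  Measure.infinitePi_map_pi (fun _ : ℕ => digitLaw p.1) (f := fun _ => Sigma.fst)
    fun _ => measurable_of_finite _

theorem lyDim_bernoulli (p : stdSimplex ℝ (Digit m)) :
    S.lyDim (bernoulli p) = S.crossDim p.1 p.1 := by
  have hfst : Measurable (Sigma.fst : Digit m → Fin N) := measurable_of_finite _
  have : IsProbabilityMeasure ((digitLaw p.1).map Sigma.fst) :=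
    Measure.isProbabilityMeasure_map hfst.aemeasurable
  have hrow : ∀ i, 0 ≤ rowSum p.1 i := rowSum_nonneg p.2.1
  have toReal : ∀ {A : Type} [Fintype A] [MeasurableSpace A] [MeasurableSingletonClass A]
      (ν : Measure A) [IsProbabilityMeasure ν],
      (ENNReal.ofReal (∑ a, Real.negMulLog (ν.real {a}))).toReal =
        -∑ a, ν.real {a} * Real.log (ν.real {a}) := by
    intro A _ _ _ ν _
    rw [ENNReal.toReal_ofReal (Finset.sum_nonneg fun a _ =>
      Real.negMulLog_nonneg measureReal_nonneg measureReal_le_one), ← Finset.sum_neg_distrib]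
    simp only [Real.negMulLog, neg_mul]
  have h1 : (ksEntropy (bernoulli p) shift).toReal = -∑ e, p.1 e * Real.log (p.1 e) := by
    rw [bernoulli, ksEntropy_infinitePi, toReal]
    simp only [measureReal_def, digitLaw_singleton, ENNReal.toReal_ofReal (p.2.1 _)]
  have h2 : (ksEntropy ((bernoulli p).map rowProj) shift).toReal =
      -∑ e, p.1 e * Real.log (rowSum p.1 e.1) := by
    rw [map_rowProj_bernoulli, ksEntropy_infinitePi, toReal,
      sum_mul_fst p.1 fun i => Real.log (rowSum p.1 i)]
    simp only [measureReal_def, Measure.map_apply hfst (measurableSet_singleton _),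
      digitLaw_fst_preimage p.2.1, ENNReal.toReal_ofReal (hrow _)]
  have h3 : S.lyapunov (bernoulli p) = S.expA p.1 := by
    rw [lyapunov, integral_bernoulli p (fun e => Real.log (S.a e)) 0, expA]
  have h4 : S.lyapunovV (bernoulli p) = S.expB p.1 := by
    rw [lyapunovV, integral_bernoulli p (fun e => Real.log (S.b e.1)) 0, expB]
  rw [lyDim, h1, h2, h3, h4, crossDim]

end LGSystem

end LalleyGatzouras

theorem corollary4p3 {N : ℕ} {m : Fin N → ℕ} (S : LalleyGatzouras.LGSystem m)
    (p : stdSimplex ℝ (LalleyGatzouras.Digit m)) :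
    (dimH (S.freqSet p.1) : EReal) = ((S.lyDim (LalleyGatzouras.bernoulli p) : ℝ) : EReal) := by
  -- Coercing `ENNReal.ofReal` to `EReal` produces a maximum with 0, which nonnegativity of the
  -- dimension formula removes.
  rw [LalleyGatzouras.LGSystem.dimH_freqSet, LalleyGatzouras.LGSystem.lyDim_bernoulli,
    EReal.coe_ennreal_ofReal, max_eq_left (LalleyGatzouras.LGSystem.crossDim_self_nonneg p)]
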